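/- All vector spaces are over $\mathbb C$. A (left) Leibniz algebra is a vector space $\mathfrak g$ with a bilinear bracket such that $[a,[b,c]]=[[a,b],c]+[b,[a,c]]$ for all $a,b,c$. Its associated Lie algebra $\mathfrak g_{Lie}$ is the quotient of $\mathfrak g$ by the linear span of the elements $[a,a]$, $a\in\mathfrak g$. A left $\mathfrak g$-module is a vector space $W$ with a bilinear action such that $a(bw)-b(aw)=[a,b]w$; this is the same thing as a $\mathfrak g_{Lie}$-module, and $\mathfrak g$ is a left module over itself through $a\cdot b=[a,b]$. The loop algebra $L(\mathfrak g)=\mathfrak g\otimes\mathbb C[t,t^{-1}]$ is the Leibniz algebra with bracket $[a\otimes t^m,b\otimes t^n]=[a,b]\otimes t^{m+n}$. An $L(\mathfrak g)$-module $W$ is restricted if for all $a\in\mathfrak g$, $w\in W$ one has $(a\otimes t^n)w=0$ for $n$ sufficiently large. A vertex Leibniz algebra is a vector space $V$ with a linear map $Y(\cdot,x):V\to\mathrm{Hom}(V,V((x)))$ such that the Jacobi identity $$x_0^{-1}\delta\Big(\tfrac{x_1-x_2}{x_0}\Big)Y(u,x_1)Y(v,x_2)-x_0^{-1}\delta\Big(\tfrac{x_2-x_1}{-x_0}\Big)Y(v,x_2)Y(u,x_1)=x_2^{-1}\delta\Big(\tfrac{x_1-x_0}{x_2}\Big)Y(Y(u,x_0)v,x_2)$$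 holds for all $u,v\in V$, where $\delta(x)=\sum_{n\in\mathbb Z}x^n$ and powers of a binomial are expanded in nonnegative powers of its second variable. A $V$-module is a vector space $W$ with a linear map $Y_W(\cdot,x):V\to\mathrm{Hom}(W,W((x)))$ such that the Jacobi identity holds on $W$, with $Y_W(u,x_1)$, $Y_W(v,x_2)$ and $Y_W(Y(u,x_0)v,x_2)$ in place of the corresponding operators. Theorem 3.5. Let $\mathfrak g$ be a Leibniz algebra. Let $L(\mathfrak g_{Lie})^+=\mathfrak g_{Lie}\otimes\mathbb C[t]$ act on $\mathfrak g$ with $\mathfrak g_{Lie}\otimes t\mathbb C[t]$ acting trivially and $\mathfrak g_{Lie}=\mathfrak g_{Lie}\otimes 1$ acting by the left action of $\mathfrak g$ on itself, and let $$V_{\mathfrak g}=U(L(\mathfrak g_{Lie}))\otimes_{U(L(\mathfrak g_{Lie})^+)}\mathfrak g$$ be the induced $L(\mathfrak g_{Lie})$-module, regarded as an $L(\mathfrak g)$-module through $L(\mathfrak g)\to L(\mathfrak g_{Lie})$. For $a\in\mathfrak g$ write $a$ also for the element $1\otimes a$ of $V_{\mathfrak g}$, and on any $L(\mathfrak g)$-module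 let $a(x)=\sum_{n\in\mathbb Z}(a\otimes t^n)x^{-n-1}$. Then there is exactly one vertex Leibniz algebra structure on $V_{\mathfrak g}$ with $Y(a,x)=a(x)$ for all $a\in\mathfrak g$. Furthermore, for every restricted $L(\mathfrak g)$-module $W$ there is exactly one $V_{\mathfrak g}$-module structure $Y_W(\cdot,x)$ on $W$ with $Y_W(a,x)=a(x)$ for all $a\in\mathfrak g$. -/

import Mathlib

open scoped TensorProduct LaurentPolynomial Polynomial

noncomputable section

/-! ## Leibniz algebras and their modules -/

/-- A (left) Leibniz algebra over `ℂ`: a vector space with a bilinear bracket satisfying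
`[a, [b, c]] = [[a, b], c] + [b, [a, c]]`. -/
class LeibnizAlgebra (𝔤 : Type*) [AddCommGroup 𝔤] [Module ℂ 𝔤] extends Bracket 𝔤 𝔤 where
  add_bracket : ∀ a b c : 𝔤, ⁅a + b, c⁆ = ⁅a, c⁆ + ⁅b, c⁆
  bracket_add : ∀ a b c : 𝔤, ⁅a, b + c⁆ = ⁅a, b⁆ + ⁅a, c⁆
  smul_bracket : ∀ (r : ℂ) (a b : 𝔤), ⁅r • a, b⁆ = r • ⁅a, b⁆
  bracket_smul : ∀ (r : ℂ) (a b : 𝔤), ⁅a, r • b⁆ = r • ⁅a, b⁆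
  leibniz : ∀ a b c : 𝔤, ⁅a, ⁅b, c⁆⁆ = ⁅⁅a, b⁆, c⁆ + ⁅b, ⁅a, c⁆⁆

namespace LeibnizAlgebra

attribute [local instance 100] LieRing.ofAssociativeRing

/-- A left module structure on the vector space `W` for the Leibniz algebra `𝔤`:
a linear action with `a (b w) - b (a w) = [a, b] w`. -/
structure LeftModule (𝔤 : Type*) [AddCommGroup 𝔤] [Module ℂ 𝔤] [LeibnizAlgebra 𝔤]
    (W : Type*) [AddCommGroup W] [Module ℂ W] where
  act : 𝔤 →ₗ[ℂ] Module.End ℂ W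
  act_bracket : ∀ (a b : 𝔤) (w : W), act a (act b w) - act b (act a w) = act ⁅a, b⁆ w

variable (𝔤 : Type*) [AddCommGroup 𝔤] [Module ℂ 𝔤] [LeibnizAlgebra 𝔤]

/-- The bracket as a bilinear map. -/
def bracketBilin : 𝔤 →ₗ[ℂ] 𝔤 →ₗ[ℂ] 𝔤 :=
  LinearMap.mk₂ ℂ (fun a b => ⁅a, b⁆) add_bracket smul_bracket bracket_add bracket_smul

/-- `𝔤` as a left module over itself, `a` acting by `b ↦ [a, b]`. -/
def adjointModule : LeftModule 𝔤 𝔤 where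
  act := bracketBilin 𝔤
  act_bracket a b w := sub_eq_iff_eq_add.mpr (leibniz a b w)

/-! ## The Lie algebra `𝔤_Lie` -/

/-- The linear span of all the squares `[a, a]`. -/
def squares : Submodule ℂ 𝔤 := Submodule.span ℂ (Set.range fun a : 𝔤 => ⁅a, a⁆)

/-- The associated Lie algebra `𝔤_Lie`, the quotient of `𝔤` by the span of the squares. -/
def LieQuotient : Type _ := 𝔤 ⧸ squares 𝔤

instance : AddCommGroup (LieQuotient 𝔤) := inferInstanceAs (AddCommGroup (𝔤 ⧸ squares 𝔤))

instance : Module ℂ (LieQuotient 𝔤) := inferInstanceAs (Module ℂ (𝔤 ⧸ squares 𝔤))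

/-- The quotient map `𝔤 → 𝔤_Lie`. -/
def toLieQuotient : 𝔤 →ₗ[ℂ] LieQuotient 𝔤 := (squares 𝔤).mkQ

variable {𝔤}

/-- Every left module is annihilated by the squares. -/
theorem LeftModule.act_squares {W : Type*} [AddCommGroup W] [Module ℂ W] (ρ : LeftModule 𝔤 W) :
    squares 𝔤 ≤ LinearMap.ker ρ.act := by
  refine Submodule.span_le.mpr ?_
  rintro _ ⟨a, rfl⟩
  refine LinearMap.ext fun w => ?_
  simpa using (ρ.act_bracket a a w).symm

theorem bracket_mem_squares (a : 𝔤) {x : 𝔤} (hx : x ∈ squares 𝔤) : ⁅a, x⁆ ∈ squares 𝔤 := by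
  have hsym : ∀ b c : 𝔤, ⁅b, c⁆ + ⁅c, b⁆ ∈ squares 𝔤 := fun b c => by
    have h : ⁅b, c⁆ + ⁅c, b⁆ = ⁅b + c, b + c⁆ - ⁅b, b⁆ - ⁅c, c⁆ := by
      rw [add_bracket, bracket_add, bracket_add]; abel
    rw [h]
    exact sub_mem (sub_mem (Submodule.subset_span ⟨_, rfl⟩) (Submodule.subset_span ⟨_, rfl⟩))
      (Submodule.subset_span ⟨_, rfl⟩)
  refine (Submodule.span_le (p := (squares 𝔤).comap (bracketBilin 𝔤 a))).mpr ?_ hx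
  rintro _ ⟨b, rfl⟩
  change ⁅a, ⁅b, b⁆⁆ ∈ squares 𝔤
  rw [leibniz]
  exact hsym _ _

variable (𝔤) in
/-- The bracket of `𝔤_Lie`, induced from that of `𝔤`. -/
def quotientBracket : LieQuotient 𝔤 →ₗ[ℂ] LieQuotient 𝔤 →ₗ[ℂ] LieQuotient 𝔤 :=
  (squares 𝔤).liftQ
    { toFun := fun a => (squares 𝔤).mapQ (squares 𝔤) (bracketBilin 𝔤 a)
        fun _ hx => bracket_mem_squares a hx
      map_add' := fun a b => Submodule.linearMap_qext _ <| LinearMap.ext fun c =>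
        congrArg (squares 𝔤).mkQ (add_bracket a b c)
      map_smul' := fun r a => Submodule.linearMap_qext _ <| LinearMap.ext fun c =>
        congrArg (squares 𝔤).mkQ (smul_bracket r a c) }
    (fun x hx => Submodule.linearMap_qext _ <| LinearMap.ext fun c => by
      have h : ⁅x, c⁆ = 0 := LinearMap.congr_fun ((adjointModule 𝔤).act_squares hx) c
      exact (congrArg (squares 𝔤).mkQ h).trans (map_zero _))

instance : LieRing (LieQuotient 𝔤) where
  bracket x y := quotientBracket 𝔤 x y
  add_lie x y z := LinearMap.congr_fun (map_add (quotientBracket 𝔤) x y) z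
  lie_add x y z := map_add (quotientBracket 𝔤 x) y z
  lie_self x := by
    obtain ⟨a, rfl⟩ := (squares 𝔤).mkQ_surjective x
    exact (Submodule.Quotient.mk_eq_zero _).mpr (Submodule.subset_span ⟨a, rfl⟩)
  leibniz_lie x y z := by
    obtain ⟨a, rfl⟩ := (squares 𝔤).mkQ_surjective x
    obtain ⟨b, rfl⟩ := (squares 𝔤).mkQ_surjective y
    obtain ⟨c, rfl⟩ := (squares 𝔤).mkQ_surjective z
    exact congrArg (squares 𝔤).mkQ (leibniz a b c)

instance : LieAlgebra ℂ (LieQuotient 𝔤) where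
  lie_smul r x y := map_smul (quotientBracket 𝔤 x) r y

theorem toLieQuotient_bracket (a b : 𝔤) :
    toLieQuotient 𝔤 ⁅a, b⁆ = ⁅toLieQuotient 𝔤 a, toLieQuotient 𝔤 b⁆ := rfl

/-- A left `𝔤`-module regarded as a module for the Lie algebra `𝔤_Lie`. -/
def LeftModule.toLieHom {W : Type*} [AddCommGroup W] [Module ℂ W] (ρ : LeftModule 𝔤 W) :
    LieQuotient 𝔤 →ₗ⁅ℂ⁆ Module.End ℂ W where
  toLinearMap := (squares 𝔤).liftQ ρ.act ρ.act_squares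
  map_lie' {x y} := by
    obtain ⟨a, rfl⟩ := (squares 𝔤).mkQ_surjective x
    obtain ⟨b, rfl⟩ := (squares 𝔤).mkQ_surjective y
    exact LinearMap.ext fun w => (ρ.act_bracket a b w).symm

/-! ## Loop algebras -/

variable (𝔤)

/-- The loop algebra `L(𝔤) = 𝔤 ⊗ ℂ[t, t⁻¹]`. -/
abbrev Loop : Type _ := ℂ[T;T⁻¹] ⊗[ℂ] 𝔤

/-- The bilinear bracket of `L(𝔤)`: `[a ⊗ f, b ⊗ g] = [a, b] ⊗ f g`. -/
def loopBracket : Loop 𝔤 →ₗ[ℂ] Loop 𝔤 →ₗ[ℂ] Loop 𝔤 :=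
  TensorProduct.map₂ (LinearMap.mul ℂ ℂ[T;T⁻¹]) (bracketBilin 𝔤)

theorem loopBracket_tmul (f g : ℂ[T;T⁻¹]) (a b : 𝔤) :
    loopBracket 𝔤 (f ⊗ₜ a) (g ⊗ₜ b) = (f * g) ⊗ₜ ⁅a, b⁆ := rfl

instance : LeibnizAlgebra (Loop 𝔤) where
  bracket x y := loopBracket 𝔤 x y
  add_bracket x y z := LinearMap.map_add₂ (loopBracket 𝔤) x y z
  bracket_add x y z := map_add (loopBracket 𝔤 x) y z
  smul_bracket r x y := LinearMap.map_smul₂ (loopBracket 𝔤) r x y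
  bracket_smul r x y := map_smul (loopBracket 𝔤 x) r y
  leibniz x y z := by
    change loopBracket 𝔤 x (loopBracket 𝔤 y z) =
      loopBracket 𝔤 (loopBracket 𝔤 x y) z + loopBracket 𝔤 y (loopBracket 𝔤 x z)
    induction x using TensorProduct.induction_on with
    | zero => simp
    | add x₁ x₂ h₁ h₂ => simp only [map_add, LinearMap.add_apply, h₁, h₂]; abel
    | tmul f a =>
      induction y using TensorProduct.induction_on with
      | zero => simp
      | add y₁ y₂ h₁ h₂ => simp only [map_add, LinearMap.add_apply, h₁, h₂]; abel
      | tmul g b =>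
        induction z using TensorProduct.induction_on with
        | zero => simp
        | add z₁ z₂ h₁ h₂ => simp only [map_add, h₁, h₂]; abel
        | tmul h c =>
          simp only [loopBracket_tmul]
          rw [leibniz a b c, TensorProduct.tmul_add, mul_assoc, mul_left_comm g f h]

/-- The loop algebra `L(𝔤_Lie)`, with the Lie bracket `[x ⊗ f, y ⊗ g] = [x, y] ⊗ f g`. -/
abbrev LieLoop : Type _ := ℂ[T;T⁻¹] ⊗[ℂ] LieQuotient 𝔤

/-- The Lie algebra `L(𝔤_Lie)⁺ = 𝔤_Lie ⊗ ℂ[t]`. -/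
abbrev LieLoopPlus : Type _ := ℂ[X] ⊗[ℂ] LieQuotient 𝔤

/-- The inclusion of `L(𝔤_Lie)⁺` into `L(𝔤_Lie)`. -/
def loopPlusIncl : LieLoopPlus 𝔤 →ₗ⁅ℂ⁆ LieLoop 𝔤 :=
  LieAlgebra.ExtendScalars.map Polynomial.toLaurentAlg LieHom.id

/-- The map `L(𝔤) → L(𝔤_Lie)` induced by `𝔤 → 𝔤_Lie`. -/
def loopToLieLoop : Loop 𝔤 →ₗ[ℂ] LieLoop 𝔤 := (toLieQuotient 𝔤).lTensor ℂ[T;T⁻¹]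

theorem loopToLieLoop_bracket (x y : Loop 𝔤) :
    loopToLieLoop 𝔤 ⁅x, y⁆ = ⁅loopToLieLoop 𝔤 x, loopToLieLoop 𝔤 y⁆ := by
  change loopToLieLoop 𝔤 (loopBracket 𝔤 x y) = _
  induction x using TensorProduct.induction_on with
  | zero =>
    rw [map_zero, map_zero, LinearMap.zero_apply, map_zero]
    exact (zero_lie (L := LieLoop 𝔤) (M := LieLoop 𝔤) _).symm
  | add x₁ x₂ h₁ h₂ =>
    rw [map_add, map_add, LinearMap.add_apply, map_add, h₁, h₂]
    exact (add_lie (L := LieLoop 𝔤) (M := LieLoop 𝔤) _ _ _).symm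
  | tmul f a =>
    induction y using TensorProduct.induction_on with
    | zero =>
      rw [map_zero, map_zero]
      exact (lie_zero (L := LieLoop 𝔤) (M := LieLoop 𝔤) _).symm
    | add y₁ y₂ h₁ h₂ =>
      rw [map_add, map_add, map_add, h₁, h₂]
      exact (lie_add (L := LieLoop 𝔤) (M := LieLoop 𝔤) _ _ _).symm
    | tmul g b => rfl

/-! ## The induced module `V_𝔤` -/

section Induced

variable {𝔤}
variable {U : Type*} [AddCommGroup U] [Module ℂ U] (ρ : LeftModule 𝔤 U)

/-- The action of `L(𝔤_Lie)⁺ = 𝔤_Lie ⊗ ℂ[t]` on a `𝔤`-module `U`: the part `𝔤_Lie ⊗ tℂ[t]` acts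
trivially, so that `x ⊗ f` acts as `f(0) x`. -/
def plusAction : LieLoopPlus 𝔤 →ₗ⁅ℂ⁆ Module.End ℂ U where
  toLinearMap := (ρ.toLieHom : LieQuotient 𝔤 →ₗ[ℂ] Module.End ℂ U) ∘ₗ
    (TensorProduct.lid ℂ (LieQuotient 𝔤)).toLinearMap ∘ₗ
      (Polynomial.aeval (0 : ℂ)).toLinearMap.rTensor (LieQuotient 𝔤)
  map_lie' {x y} := by
    induction x using TensorProduct.induction_on with
    | zero => simp
    | add x₁ x₂ h₁ h₂ => simp_all [add_lie]
    | tmul f a =>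
      induction y using TensorProduct.induction_on with
      | zero => simp
      | add y₁ y₂ h₁ h₂ => simp_all [lie_add]
      | tmul g b => simp [smul_smul, mul_comm]

theorem plusAction_tmul (f : ℂ[X]) (a : 𝔤) (u : U) :
    plusAction ρ (f ⊗ₜ toLieQuotient 𝔤 a) u = f.eval 0 • ρ.act a u := by
  change (ρ.toLieHom (Polynomial.aeval (0 : ℂ) f • toLieQuotient 𝔤 a)) u = _
  rw [map_smul, Polynomial.coe_aeval_eq_eval]
  rfl

/-- The universal enveloping algebra `U(L(𝔤_Lie))`. -/
abbrev LoopEnv (𝔤 : Type*) [AddCommGroup 𝔤] [Module ℂ 𝔤] [LeibnizAlgebra 𝔤] : Type _ :=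
  UniversalEnvelopingAlgebra ℂ (LieLoop 𝔤)

/-- The universal enveloping algebra `U(L(𝔤_Lie)⁺)`. -/
abbrev LoopPlusEnv (𝔤 : Type*) [AddCommGroup 𝔤] [Module ℂ 𝔤] [LeibnizAlgebra 𝔤] : Type _ :=
  UniversalEnvelopingAlgebra ℂ (LieLoopPlus 𝔤)

variable (𝔤) in
/-- The algebra map `U(L(𝔤_Lie)⁺) → U(L(𝔤_Lie))` induced by the inclusion. -/
def envIncl : LoopPlusEnv 𝔤 →ₐ[ℂ] LoopEnv 𝔤 :=
  UniversalEnvelopingAlgebra.lift ℂ ((UniversalEnvelopingAlgebra.ι ℂ).comp (loopPlusIncl 𝔤))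

/-- The action of `U(L(𝔤_Lie)⁺)` on the `𝔤`-module `U`. -/
def envPlusAction : LoopPlusEnv 𝔤 →ₐ[ℂ] Module.End ℂ U :=
  UniversalEnvelopingAlgebra.lift ℂ (plusAction ρ)

/-- The relations `s p ⊗ u = s ⊗ p u` (`s ∈ U(L(𝔤_Lie))`, `p ∈ U(L(𝔤_Lie)⁺)`, `u ∈ U`) by which
the tensor product over `U(L(𝔤_Lie)⁺)` is obtained from the tensor product over `ℂ`. -/
def inducedRelations : Submodule (LoopEnv 𝔤) (LoopEnv 𝔤 ⊗[ℂ] U) :=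
  Submodule.span (LoopEnv 𝔤) {z | ∃ (s : LoopEnv 𝔤) (p : LoopPlusEnv 𝔤) (u : U),
    z = (s * envIncl 𝔤 p) ⊗ₜ[ℂ] u - s ⊗ₜ[ℂ] envPlusAction ρ p u}

/-- The induced module `V_𝔤(U) = U(L(𝔤_Lie)) ⊗_{U(L(𝔤_Lie)⁺)} U`. -/
def Induced : Type _ := (LoopEnv 𝔤 ⊗[ℂ] U) ⧸ inducedRelations ρ

instance : AddCommGroup (Induced ρ) :=
  inferInstanceAs (AddCommGroup ((LoopEnv 𝔤 ⊗[ℂ] U) ⧸ inducedRelations ρ))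

instance : Module (LoopEnv 𝔤) (Induced ρ) :=
  inferInstanceAs (Module (LoopEnv 𝔤) ((LoopEnv 𝔤 ⊗[ℂ] U) ⧸ inducedRelations ρ))

instance : Module ℂ (Induced ρ) :=
  inferInstanceAs (Module ℂ ((LoopEnv 𝔤 ⊗[ℂ] U) ⧸ inducedRelations ρ))

instance : IsScalarTower ℂ (LoopEnv 𝔤) (Induced ρ) :=
  inferInstanceAs (IsScalarTower ℂ (LoopEnv 𝔤) ((LoopEnv 𝔤 ⊗[ℂ] U) ⧸ inducedRelations ρ))

/-- The canonical map `U → V_𝔤(U)`, `u ↦ 1 ⊗ u`. -/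
def Induced.incl : U →ₗ[ℂ] Induced ρ where
  toFun u := (inducedRelations ρ).mkQ ((1 : LoopEnv 𝔤) ⊗ₜ[ℂ] u)
  map_add' u v := by rw [TensorProduct.tmul_add, map_add]; rfl
  map_smul' r u := by rw [TensorProduct.tmul_smul]; rfl

/-- `V_𝔤(U)` as a left `L(𝔤)`-module, through `L(𝔤) → L(𝔤_Lie) → U(L(𝔤_Lie))`. -/
def Induced.loopModule : LeftModule (Loop 𝔤) (Induced ρ) where
  act := (Algebra.lsmul ℂ ℂ (Induced ρ)).toLinearMap ∘ₗ
    (UniversalEnvelopingAlgebra.ι ℂ : LieLoop 𝔤 →ₗ⁅ℂ⁆ LoopEnv 𝔤).toLinearMap ∘ₗ loopToLieLoop 𝔤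
  act_bracket x y w := by
    change UniversalEnvelopingAlgebra.ι ℂ (loopToLieLoop 𝔤 x) •
        UniversalEnvelopingAlgebra.ι ℂ (loopToLieLoop 𝔤 y) • w -
      UniversalEnvelopingAlgebra.ι ℂ (loopToLieLoop 𝔤 y) •
        UniversalEnvelopingAlgebra.ι ℂ (loopToLieLoop 𝔤 x) • w =
      UniversalEnvelopingAlgebra.ι ℂ (loopToLieLoop 𝔤 ⁅x, y⁆) • w
    rw [loopToLieLoop_bracket, LieHom.map_lie, LieRing.of_associative_ring_bracket, sub_smul,
      mul_smul, mul_smul]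

end Induced

/-- The `L(𝔤)`-module `V_𝔤 = V_𝔤(𝔤)` induced from the left `𝔤`-module `𝔤`. -/
abbrev VMod : Type _ := Induced (adjointModule 𝔤)

/-- The canonical map `𝔤 → V_𝔤`, `a ↦ 1 ⊗ a`, by which elements of `𝔤` are viewed in `V_𝔤`. -/
def toVMod : 𝔤 →ₗ[ℂ] VMod 𝔤 := Induced.incl (adjointModule 𝔤)

/-- The action of `L(𝔤)` on `V_𝔤`. -/
def vmodModule : LeftModule (Loop 𝔤) (VMod 𝔤) := Induced.loopModule (adjointModule 𝔤)

section Restricted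

variable {𝔤} {W : Type*} [AddCommGroup W] [Module ℂ W] (ρ : LeftModule (Loop 𝔤) W)

/-- The formal series `a(x) = ∑ (a ⊗ tⁿ) x^{-n-1}` of operators on an `L(𝔤)`-module, as the
function sending `n` to the coefficient `a ⊗ tⁿ` of `x^{-n-1}`. -/
def LeftModule.field (a : 𝔤) (n : ℤ) : Module.End ℂ W :=
  ρ.act (LaurentPolynomial.T n ⊗ₜ[ℂ] a)

/-- An `L(𝔤)`-module is restricted if for all `a ∈ 𝔤`, `w ∈ W`, `(a ⊗ tⁿ) w = 0` for `n`
sufficiently large. -/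
def LeftModule.IsRestricted : Prop :=
  ∀ (a : 𝔤) (w : W), ∃ N : ℤ, ∀ n : ℤ, N ≤ n → ρ.field a n w = 0

end Restricted

end LeibnizAlgebra

/-! ## Vertex Leibniz algebras and their modules

A linear map `V → Hom(W, W((x)))` is a linear map into Mathlib's `VertexOperator ℂ W`, and
`VertexOperator.ncoeff A n` is the coefficient of `x^{-n-1}` of `A`. -/

section Vertex

variable {V : Type*} [AddCommGroup V] [Module ℂ V] {W : Type*} [AddCommGroup W] [Module ℂ W]

/-- The coefficient of `x₀^{-l-1} x₁^{-m-1} x₂^{-n-1}` in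
`x₀⁻¹ δ((x₁ - x₂) / x₀) A(x₁) B(x₂) w`, where `x₀⁻¹ δ((x₁ - x₂) / x₀)` is
`∑_l x₀^{-l-1} ∑_{i ≥ 0} (-1)^i (l choose i) x₁^{l-i} x₂^i`. Only finitely many terms are nonzero,
since `B(x₂) w` is a Laurent series. -/
def jacobiProd (A B : VertexOperator ℂ W) (l m n : ℤ) (w : W) : W :=
  ∑ᶠ i : ℕ, ((-1 : ℤ) ^ i * Ring.choose l i) •
    VertexOperator.ncoeff A (l + m - i) (VertexOperator.ncoeff B (n + i) w)

/-- The coefficient of `x₀^{-l-1} x₁^{-m-1} x₂^{-n-1}` in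
`x₀⁻¹ δ((x₂ - x₁) / (-x₀)) B(x₂) A(x₁) w`, where `x₀⁻¹ δ((x₂ - x₁) / (-x₀))` is
`∑_l (-1)^l x₀^{-l-1} ∑_{i ≥ 0} (-1)^i (l choose i) x₂^{l-i} x₁^i`. Only finitely many terms are
nonzero, since `A(x₁) w` is a Laurent series. -/
def jacobiRevProd (A B : VertexOperator ℂ W) (l m n : ℤ) (w : W) : W :=
  ∑ᶠ i : ℕ, ((l.negOnePow : ℤ) * (-1 : ℤ) ^ i * Ring.choose l i) •
    VertexOperator.ncoeff B (l + n - i) (VertexOperator.ncoeff A (m + i) w)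

/-- The coefficient of `x₀^{-l-1} x₁^{-m-1} x₂^{-n-1}` in
`x₂⁻¹ δ((x₁ - x₀) / x₂) Y_W(Y(u, x₀) v, x₂) w`, where `x₂⁻¹ δ((x₁ - x₀) / x₂)` is
`∑_k x₂^{-k-1} ∑_{i ≥ 0} (-1)^i (k choose i) x₁^{k-i} x₀^i`; here `k = i - m - 1`, and
`(-1)^i (i-m-1 choose i) = (m choose i)`. Only finitely many terms are nonzero, since
`Y(u, x₀) v` is a Laurent series. -/
def jacobiIterate (Y : V →ₗ[ℂ] VertexOperator ℂ V) (YW : V →ₗ[ℂ] VertexOperator ℂ W) (u v : V)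
    (l m n : ℤ) (w : W) : W :=
  ∑ᶠ i : ℕ, ((-1 : ℤ) ^ i * Ring.choose (i - m - 1) i) •
    VertexOperator.ncoeff (YW (VertexOperator.ncoeff (Y u) (l + i) v)) (m + n - i) w

/-- The Jacobi identity
`x₀⁻¹ δ((x₁ - x₂) / x₀) Y_W(u, x₁) Y_W(v, x₂) - x₀⁻¹ δ((x₂ - x₁) / (-x₀)) Y_W(v, x₂) Y_W(u, x₁)
  = x₂⁻¹ δ((x₁ - x₀) / x₂) Y_W(Y(u, x₀) v, x₂)`, coefficient by coefficient. -/
def JacobiIdentity (Y : V →ₗ[ℂ] VertexOperator ℂ V) (YW : V →ₗ[ℂ] VertexOperator ℂ W) : Prop :=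
  ∀ (u v : V) (l m n : ℤ) (w : W),
    jacobiProd (YW u) (YW v) l m n w - jacobiRevProd (YW u) (YW v) l m n w =
      jacobiIterate Y YW u v l m n w

/-- A vertex Leibniz algebra structure on the vector space `V`. -/
structure VertexLeibnizStructure (V : Type*) [AddCommGroup V] [Module ℂ V] where
  Y : V →ₗ[ℂ] VertexOperator ℂ V
  jacobi : JacobiIdentity Y Y

/-- A module structure on the vector space `W` for a vertex Leibniz algebra `V`. -/
structure VertexLeibnizModule (S : VertexLeibnizStructure V) (W : Type*) [AddCommGroup W]
    [Module ℂ W] where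
  YW : V →ₗ[ℂ] VertexOperator ℂ W
  jacobi : JacobiIdentity S.Y YW

end Vertex

end

/-! On any space `W`, vertex operators have n-th products `A_n B`, the residues in `x₁` of `(x₁ -
x)^n A(x₁) B(x) - (-x + x₁)^n B(x) A(x₁)`. If `A` and `B` are mutually local, they satisfy the
Jacobi identity with these products in the iterate (`VertexOperator.IsLocal.jacobiDiff_eq_finsum`).
Hence a linear map `Y_W` with pairwise local values and `Y_W(u_n v) = Y_W(u)_n Y_W(v)` satisfies the
Jacobi identity. Conversely, the residue in `x₁` of the Jacobi identity is this compatibility. As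
`V_𝔤` is generated from `𝔤` by the operators `a ⊗ tⁿ`, it determines `Y_W` from the fields `a(x)`,
which is uniqueness.

For existence, the bracket of the loop algebra makes `a(x)` and `b(x)` local on a restricted module,
with `a(x)_0 b(x) = [a,b](x)` and `a(x)_n b(x) = 0` for `n > 0`. By the commutator formula
(`VertexOperator.IsLocal.nthProd_commutator`), letting `a ⊗ tⁿ` act by `a(x)_n` makes the space of
all vertex operators on `W` an `L(𝔤)`-module. The fields `a(x)` satisfy in it the relations defining
the induced module, so its universal property gives `Y_W`. Dong's lemma spreads locality from `𝔤` to
`V_𝔤`, and the formula for `(A_l B)_n C` spreads the compatibility. The case `W = V_𝔤` gives `Y`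
itself.

The identities for three fields rest on one device. Residues weighted by `(x₁ - x₂)^l (x₁ - x₃)^m
(x₂ - x₃)^n` obey a recursion coming from `x₁ - x₂ = (x₁ - x₃) - (x₂ - x₃)`, and a solution that
vanishes for large values of one exponent is determined by the slice where another exponent is zero.
-/

noncomputable section

/-! ### Binomial expansions as operators on functions on a lattice. -/

section BinomialExpansion

variable {G W : Type*} [AddCommGroup G] [AddCommGroup W]

/-- The expansion of `(s (x - y)) ^ l` in nonnegative powers of `y`, where a group element acts on
functions by translation of the argument. -/
def binExp (s : ℤˣ) (x y : G) (l : ℤ) (f : G → W) (v : G) : W :=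
  ∑ᶠ i : ℕ, (((s ^ l : ℤˣ) : ℤ) * (-1 : ℤ) ^ i * Ring.choose l i) •
    f (v + (l - i) • x + (i : ℤ) • y)

/-- Only finitely many values of `f` on each ray in the direction `α` are nonzero. -/
def RayFinite (α : G) (f : G → W) : Prop := ∀ v, {i : ℕ | f (v + (i : ℤ) • α) ≠ 0}.Finite

/-- Only finitely many values of `f` on each cone spanned by `α` and `β` are nonzero. -/
def ConeFinite (α β : G) (f : G → W) : Prop :=
  ∀ v, {p : ℕ × ℕ | f (v + (p.1 : ℤ) • α + (p.2 : ℤ) • β) ≠ 0}.Finite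

/-- `γ` is a nonzero nonnegative combination of `α` and `β`. -/
def InCone (α β γ : G) : Prop :=
  ∃ a b : ℕ, 0 < a + b ∧ γ = (a : ℤ) • α + (b : ℤ) • β

theorem RayFinite.eventually_eq_zero {α : G} {f : G → W} (hf : RayFinite α f) (v : G) :
    ∃ K : ℕ, ∀ i : ℕ, K ≤ i → f (v + (i : ℤ) • α) = 0 := by
  obtain ⟨K, hK⟩ := (hf v).bddAbove
  refine ⟨K + 1, fun i hi => ?_⟩
  by_contra h
  have : i ≤ K := hK h
  omega

theorem binExp_arg (x y v : G) (l i : ℤ) :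
    v + (l - i) • x + i • y = v + l • x + i • (y - x) := by
  rw [sub_smul, smul_sub]; abel

theorem RayFinite.term_support_finite {x y : G} {f : G → W} (hf : RayFinite (y - x) f)
    (c : ℕ → ℤ) (l : ℤ) (v : G) :
    (Function.support fun i : ℕ => c i • f (v + (l - i) • x + (i : ℤ) • y)).Finite := by
  refine (hf (v + l • x)).subset fun i hi => ?_
  rw [Function.mem_support, binExp_arg] at hi
  exact fun h => hi (by rw [h, smul_zero])

theorem binExp_eq_sum (s : ℤˣ) {x y : G} {l : ℤ} {f : G → W} {v : G} {K : ℕ}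
    (hK : ∀ i : ℕ, K ≤ i → f (v + (l - i) • x + (i : ℤ) • y) = 0) :
    binExp s x y l f v = ∑ i ∈ Finset.range K, (((s ^ l : ℤˣ) : ℤ) * (-1 : ℤ) ^ i *
      Ring.choose l i) • f (v + (l - i) • x + (i : ℤ) • y) := by
  refine finsum_eq_sum_of_support_subset _ fun i hi => ?_
  rw [Finset.mem_coe, Finset.mem_range]
  by_contra h
  exact hi (by simp only [hK i (not_lt.mp h), smul_zero])

theorem binExp_congr {s : ℤˣ} {x y : G} {l : ℤ} {f g : G → W} {v : G}
    (h : ∀ i : ℕ, f (v + (l - i) • x + (i : ℤ) • y) = g (v + (l - i) • x + (i : ℤ) • y)) :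
    binExp s x y l f v = binExp s x y l g v :=
  finsum_congr fun i => by rw [h i]

theorem binExp_zero (s : ℤˣ) (x y : G) (f : G → W) : binExp s x y 0 f = f := by
  funext v
  rw [binExp, finsum_eq_single _ 0]
  · simp
  · intro i hi
    rw [Ring.choose_zero_pos ℤ (Nat.pos_of_ne_zero hi), mul_zero, zero_smul]

theorem binExp_translate (s : ℤˣ) (x y : G) (l : ℤ) (f : G → W) (t v : G) :
    binExp s x y l (fun u => f (u + t)) v = binExp s x y l f (v + t) := by
  refine finsum_congr fun i => ?_
  beta_reduce
  rw [show v + (l - i) • x + (i : ℤ) • y + t = v + t + (l - i) • x + (i : ℤ) • y by abel]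

theorem binExp_sub (s : ℤˣ) {x y : G} (l : ℤ) {f g : G → W} (hf : RayFinite (y - x) f)
    (hg : RayFinite (y - x) g) (v : G) :
    binExp s x y l (fun u => f u - g u) v = binExp s x y l f v - binExp s x y l g v := by
  simp only [binExp, smul_sub]
  exact finsum_sub_distrib (hf.term_support_finite _ l v) (hg.term_support_finite _ l v)

theorem ConeFinite.translate {α β : G} {f : G → W} (hf : ConeFinite α β f) (t : G) :
    ConeFinite α β fun u => f (u + t) := fun v => by
  convert hf (v + t) using 5
  abel

/-- Pascal's rule, read as multiplication by one more factor `s (x - y)`. Finiteness along the ray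
lets all three sums be truncated together. -/
theorem binExp_succ (s : ℤˣ) {x y : G} (l : ℤ) {f : G → W} (hf : RayFinite (y - x) f) (v : G) :
    binExp s x y (l + 1) f v =
      s • (binExp s x y l f (v + x) - binExp s x y l f (v + y)) := by
  obtain ⟨K, hK⟩ := hf.eventually_eq_zero (v + (l + 1) • x)
  have h0 : ∀ i : ℕ, K ≤ i → f (v + (l + 1 - i) • x + (i : ℤ) • y) = 0 := fun i hi => by
    rw [binExp_arg]; exact hK i hi
  have h1 : ∀ i : ℕ, v + x + (l - i) • x + (i : ℤ) • y = v + (l + 1 - i) • x + (i : ℤ) • y :=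
    fun i => by rw [show l + 1 - (i : ℤ) = l - i + 1 by ring, add_smul, one_smul]; abel
  have h2 : ∀ i : ℕ, v + y + (l - i) • x + (i : ℤ) • y =
      v + (l + 1 - (i + 1 : ℕ)) • x + ((i + 1 : ℕ) : ℤ) • y := fun i => by
    push_cast
    rw [show l + 1 - ((i : ℤ) + 1) = l - i by ring, add_smul, one_smul]; abel
  rw [binExp_eq_sum s (K := K + 1) (fun i hi => h0 i (by omega)),
    binExp_eq_sum s (v := v + x) (K := K + 1) (fun i hi => by rw [h1]; exact h0 i (by omega)),
    binExp_eq_sum s (v := v + y) (K := K) (fun i hi => by rw [h2]; exact h0 _ (by omega))]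
  simp only [h1, h2]
  rw [Finset.sum_range_succ', Finset.sum_range_succ' (n := K), add_sub_right_comm (α := W),
    ← Finset.sum_sub_distrib, smul_add, Finset.smul_sum]
  congr 1
  · refine Finset.sum_congr rfl fun i _ => ?_
    rw [← sub_smul, Units.smul_def, smul_smul, Ring.choose_succ_succ, zpow_add_one]
    congr 1
    push_cast
    ring
  · rw [Units.smul_def, smul_smul, Ring.choose_zero_right, Ring.choose_zero_right, zpow_add_one]
    congr 1
    push_cast
    ring

theorem ConeFinite.rayFinite {α β γ : G} {f : G → W} (hf : ConeFinite α β f)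
    (hγ : InCone α β γ) : RayFinite γ f := by
  obtain ⟨a, b, hab, rfl⟩ := hγ
  intro v
  refine ((hf v).preimage (f := fun i : ℕ => (i * a, i * b)) ?_).subset fun i hi => ?_
  · intro i _ j _ h
    rcases Nat.eq_zero_or_pos a with rfl | ha
    · exact Nat.eq_of_mul_eq_mul_right (by omega) (Prod.ext_iff.mp h).2
    · exact Nat.eq_of_mul_eq_mul_right ha (Prod.ext_iff.mp h).1
  · change f _ ≠ 0
    convert hi using 2
    push_cast
    rw [smul_add, mul_smul, mul_smul, add_assoc]

theorem exists_ne_zero_of_binExp_ne_zero {s : ℤˣ} {x y : G} {l : ℤ} {f : G → W} {v : G}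
    (h : binExp s x y l f v ≠ 0) : ∃ i : ℕ, f (v + l • x + (i : ℤ) • (y - x)) ≠ 0 := by
  by_contra! h'
  refine h ?_
  rw [binExp_eq_sum s (K := 0) fun i _ => ?_, Finset.sum_range_zero]
  rw [binExp_arg]; exact h' i

/-- A nonzero value at `p` forces a nonzero value of `f` at some point of the cone above `p`, and
only finitely many points of `ℕ × ℕ` lie below finitely many others. -/
theorem ConeFinite.binExp {α β x y : G} {f : G → W} (hf : ConeFinite α β f)
    (hxy : InCone α β (y - x)) (s : ℤˣ) (l : ℤ) : ConeFinite α β (binExp s x y l f) := by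
  obtain ⟨a, b, -, hγ⟩ := hxy
  intro v
  refine ((hf (v + l • x)).biUnion fun q _ => Set.finite_Iic q).subset fun p hp => ?_
  obtain ⟨i, hi⟩ := exists_ne_zero_of_binExp_ne_zero hp
  rw [Set.mem_iUnion₂]
  refine ⟨(p.1 + i * a, p.2 + i * b), ?_, ⟨Nat.le_add_right _ _, Nat.le_add_right _ _⟩⟩
  change f _ ≠ 0
  convert hi using 2
  rw [hγ]
  push_cast
  rw [add_smul, add_smul, smul_add, mul_smul, mul_smul]
  abel

/-- Both expansions move in nonzero directions of one cone, so the double sum has finite support and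
its order can be exchanged. If the support in the cone lies below `(M, N)`, then `i` and `j` are at
most `M + N`, because each step raises the sum of the two cone coordinates by at least one. -/
theorem ConeFinite.binExp_comm {α β x y x' y' : G} {f : G → W} (hf : ConeFinite α β f)
    (h : InCone α β (y - x)) (h' : InCone α β (y' - x')) (s s' : ℤˣ) (l l' : ℤ) :
    _root_.binExp s x y l (_root_.binExp s' x' y' l' f) =
      _root_.binExp s' x' y' l' (_root_.binExp s x y l f) := by
  have key : ∀ v, ∃ K : ℕ, ∀ i j : ℕ, K ≤ i ∨ K ≤ j →
      f (v + l • x + l' • x' + (i : ℤ) • (y - x) + (j : ℤ) • (y' - x')) = 0 := by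
    intro v
    obtain ⟨a, b, hab, hγ⟩ := h
    obtain ⟨c, d, hcd, hδ⟩ := h'
    obtain ⟨⟨M, N⟩, hM⟩ := (hf (v + l • x + l' • x')).bddAbove
    refine ⟨M + N + 1, fun i j hij => ?_⟩
    by_contra hne
    have hle : (i * a + j * c, i * b + j * d) ≤ (M, N) := by
      apply hM
      change f _ ≠ 0
      convert hne using 2
      rw [hγ, hδ]
      push_cast
      rw [add_smul, add_smul, smul_add, smul_add, mul_smul, mul_smul, mul_smul, mul_smul]
      abel
    obtain ⟨h1, h2⟩ := Prod.mk_le_mk.mp hle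
    have e1 : i ≤ i * (a + b) := Nat.le_mul_of_pos_right i hab
    have e2 : j ≤ j * (c + d) := Nat.le_mul_of_pos_right j hcd
    rw [mul_add] at e1 e2
    omega
  funext v
  obtain ⟨K, hK⟩ := key v
  have hl : ∀ i j : ℕ, v + (l - i) • x + (i : ℤ) • y + (l' - j) • x' + (j : ℤ) • y' =
      v + l • x + l' • x' + (i : ℤ) • (y - x) + (j : ℤ) • (y' - x') := fun i j => by
    rw [binExp_arg, binExp_arg]; abel
  have hr : ∀ i j : ℕ, v + (l' - j) • x' + (j : ℤ) • y' + (l - i) • x + (i : ℤ) • y =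
      v + l • x + l' • x' + (i : ℤ) • (y - x) + (j : ℤ) • (y' - x') := fun i j => by
    rw [binExp_arg, binExp_arg]; abel
  have inl : ∀ i : ℕ, _root_.binExp s' x' y' l' f (v + (l - i) • x + (i : ℤ) • y) = _ :=
    fun i => binExp_eq_sum s' (K := K) fun j hj => by rw [hl]; exact hK i j (Or.inr hj)
  have inr : ∀ j : ℕ, _root_.binExp s x y l f (v + (l' - j) • x' + (j : ℤ) • y') = _ :=
    fun j => binExp_eq_sum s (K := K) fun i hi => by rw [hr]; exact hK i j (Or.inl hi)
  rw [binExp_eq_sum s (K := K), binExp_eq_sum s' (K := K)]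
  · simp only [inl, inr, hl, hr, Finset.smul_sum]
    rw [Finset.sum_comm]
    refine Finset.sum_congr rfl fun j _ => Finset.sum_congr rfl fun i _ => ?_
    rw [smul_comm]
  · intro j hj
    rw [inr]
    refine Finset.sum_eq_zero fun i _ => ?_
    rw [hr, hK i j (Or.inr hj), smul_zero]
  · intro i hi
    rw [inl]
    refine Finset.sum_eq_zero fun j _ => ?_
    rw [hl, hK i j (Or.inl hi), smul_zero]

end BinomialExpansion

/-! ### The recursion for residues in three exponents. -/

section Cocycle

variable {W : Type*} [AddCommGroup W]

/-- The recursion satisfied by the residues of `(x₁ - x₂)^l (x₁ - x₃)^m (x₂ - x₃)^n`. -/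
def BinomialCocycle (D : ℤ → ℤ → ℤ → W) : Prop :=
  ∀ l m n, D (l + 1) m n = D l (m + 1) n - D l m (n + 1)

theorem BinomialCocycle.sub {D E : ℤ → ℤ → ℤ → W} (hD : BinomialCocycle D)
    (hE : BinomialCocycle E) : BinomialCocycle fun l m n => D l m n - E l m n := fun l m n => by
  simp only [hD l m n, hE l m n]; abel

/-- Upwards in `l` the recursion is used as it stands. Downwards it reads `D l m n = D (l + 1) (m -
1) n + D l (m - 1) (n + 1)`; once level `l + 1` vanishes, vanishing on level `l` descends from `n ≥
N` to every `n`. -/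
theorem BinomialCocycle.eq_zero {D : ℤ → ℤ → ℤ → W} (hD : BinomialCocycle D) {N : ℤ}
    (hN : ∀ l m n, N ≤ n → D l m n = 0) (h0 : ∀ m n, D 0 m n = 0) (l m n : ℤ) : D l m n = 0 := by
  induction l generalizing m n with
  | zero => exact h0 m n
  | succ l ih => rw [hD, ih, ih, sub_zero]
  | pred l ih =>
    rcases le_or_gt N n with hn | hn
    · exact hN _ _ _ hn
    · have step : ∀ k : ℕ, ∀ m n : ℤ, N - k ≤ n → D (-(l : ℤ) - 1) m n = 0 := by
        intro k
        induction k with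
        | zero => intro m n hn; exact hN _ _ _ (by simpa using hn)
        | succ k ihk =>
          intro m n hn
          have h := hD (-(l : ℤ) - 1) (m - 1) n
          rw [sub_add_cancel, ih, sub_add_cancel, ihk (m - 1) (n + 1) (by push_cast at hn; omega),
            sub_zero] at h
          exact h.symm
      exact step (N - n).toNat m n (by omega)

/-- A cocycle vanishing for large third argument is given by expanding `(x₁ - x₂)^l` in powers of
`x₂ - x₃`. -/
theorem BinomialCocycle.eq_finsum {D : ℤ → ℤ → ℤ → W} (hD : BinomialCocycle D) {N : ℤ}
    (hN : ∀ l m n, N ≤ n → D l m n = 0) (l m n : ℤ) :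
    D l m n = ∑ᶠ i : ℕ, ((-1 : ℤ) ^ i * Ring.choose l i) • D 0 (l + m - i) (n + i) := by
  let f : ℤ × ℤ → W := fun v => D 0 v.1 v.2
  have hf : RayFinite ((0, 1) - (1, 0) : ℤ × ℤ) f := fun v => by
    refine (Set.finite_Iio (N - v.2).toNat).subset fun i hi => ?_
    by_contra h
    refine hi (hN _ _ _ ?_)
    rw [Set.mem_Iio] at h
    simp
    omega
  -- The expansion of the slice `l = 0` is itself a cocycle, vanishes for `n ≥ N` and agrees with
  -- `D` at `l = 0`; uniqueness applies to the difference.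
  let E : ℤ → ℤ → ℤ → W := fun l m n => D l m n - binExp 1 (1, 0) (0, 1) l f (m, n)
  have hE : BinomialCocycle E := hD.sub fun l m n => by
    rw [binExp_succ 1 l hf]; simp
  have h := hE.eq_zero (N := N) (fun l m n hn => ?_) (fun m n => ?_) l m n
  · rw [sub_eq_zero] at h
    rw [h]
    refine finsum_congr fun i => ?_
    simp [f]
    ring_nf
  · simp only [E]
    rw [hN _ _ _ hn, binExp_eq_sum 1 (f := f) (K := 0) fun i _ => hN _ _ _ (by simp; omega)]
    simp
  · simp only [E, binExp_zero, f, sub_self]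

/-- A cocycle vanishing for large first argument is given by expanding `(x₁ - x₃)^m` in powers of
`x₁ - x₂`. -/
theorem BinomialCocycle.eq_finsum_choose {D : ℤ → ℤ → ℤ → W} (hD : BinomialCocycle D) {N : ℤ}
    (hN : ∀ l m n, N ≤ l → D l m n = 0) (l m n : ℤ) :
    D l m n = ∑ᶠ i : ℕ, (Ring.choose m i) • D (l + i) 0 (m + n - i) := by
  -- Up to this sign the recursion is invariant under cyclic rotation of the exponents, which moves
  -- the vanishing from the first argument to the third.
  let E : ℤ → ℤ → ℤ → W := fun a b c => c.negOnePow • D c a b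
  have hE : BinomialCocycle E := fun a b c => by
    simp only [E, hD c a b, Int.negOnePow_succ, smul_sub, Units.neg_smul]
    abel
  have h := hE.eq_finsum (N := N) (fun a b c hc => by simp only [E, hN c a b hc, smul_zero]) m n l
  simp only [E] at h
  rw [← one_smul ℤˣ (D l m n), ← Int.units_mul_self l.negOnePow, mul_smul, h,
    smul_finsum' (l.negOnePow)]
  · refine finsum_congr fun i => ?_
    simp only [Units.smul_def, smul_smul]
    congr 1
    rw [Int.negOnePow_add, Units.val_mul]
    have h1 : ((l.negOnePow : ℤˣ) : ℤ) * (l.negOnePow : ℤˣ) = 1 := by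
      rw [← Units.val_mul, Int.units_mul_self, Units.val_one]
    have h2 : (((i : ℤ).negOnePow : ℤˣ) : ℤ) = (-1) ^ i := by
      simp [Int.negOnePow]
    have h3 : ((-1 : ℤ) ^ i) * (-1) ^ i = 1 := by rw [← mul_pow]; simp
    rw [h2]
    linear_combination (Ring.choose m i * (-1 : ℤ) ^ i * (-1 : ℤ) ^ i) * h1 + Ring.choose m i * h3
  · refine (Set.finite_Iio (N - l).toNat).subset fun i hi => ?_
    by_contra h
    rw [Set.mem_Iio] at h
    refine hi ?_
    simp only [hN (l + i) _ _ (by omega), smul_zero]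

end Cocycle

/-! ### The n-th products of vertex operators, locality, and the Jacobi identity for two fields. -/

section NthProducts

open VertexOperator

variable {W : Type*} [AddCommGroup W] [Module ℂ W]

theorem VertexOperator.exists_ncoeff_eq_zero (A : VertexOperator ℂ W) (w : W) :
    ∃ N : ℤ, ∀ n, N ≤ n → (ncoeff A n) w = 0 :=
  ⟨_, fun n hn => A.ncoeff_eq_zero_of_lt_order n w
    (show -n - 1 < _ by
      linarith [show -HahnSeries.order ((HahnModule.of ℂ).symm (A w)) ≤ n from hn])⟩

theorem VertexOperator.ncoeff_injective :
    Function.Injective (VertexOperator.ncoeff : VertexOperator ℂ W →ₗ[ℂ] ℤ → Module.End ℂ W) :=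
  fun A B h => HVertexOperator.coeff_inj <| funext fun n => by
    rw [VertexOperator.coeff_eq_ncoeff, VertexOperator.coeff_eq_ncoeff, h]

/-- The vertex operator with prescribed normalized coefficients. -/
def VertexOperator.ofNCoeff (f : ℤ → Module.End ℂ W)
    (hf : ∀ w, ∃ N : ℤ, ∀ n, N ≤ n → f n w = 0) : VertexOperator ℂ W :=
  VertexOperator.of_coeff (fun n => f (-n - 1)) fun w => by
    obtain ⟨N, hN⟩ := hf w
    refine ⟨-N, fun n hn => ?_⟩
    by_contra h
    exact hn (hN _ (by omega))

@[simp]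
theorem VertexOperator.ncoeff_ofNCoeff (f : ℤ → Module.End ℂ W)
    (hf : ∀ w, ∃ N : ℤ, ∀ n, N ≤ n → f n w = 0) (n : ℤ) :
    (ncoeff (VertexOperator.ofNCoeff f hf) n) = f n := by
  rw [VertexOperator.ofNCoeff, VertexOperator.ncoeff_of_coeff, neg_sub, sub_neg_eq_add,
    add_sub_cancel_left]

theorem VertexOperator.exists_nat_ncoeff_eq_zero (A : VertexOperator ℂ W) (n : ℤ) (w : W) :
    ∃ K : ℕ, ∀ i : ℕ, K ≤ i → (ncoeff A (n + i)) w = 0 := by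
  obtain ⟨N, hN⟩ := A.exists_ncoeff_eq_zero w
  exact ⟨(N - n).toNat, fun i hi => hN _ (by omega)⟩

theorem jacobi_support_finite (A B : VertexOperator ℂ W) (k n : ℤ) (w : W) (c : ℕ → ℤ) :
    (Function.support fun i : ℕ => c i • (ncoeff A (k - i)) ((ncoeff B (n + i)) w)).Finite := by
  obtain ⟨K, hK⟩ := B.exists_nat_ncoeff_eq_zero n w
  refine (Set.finite_Iio K).subset fun i hi => ?_
  by_contra h
  exact hi (by simp only [hK i (not_lt.mp h), map_zero, smul_zero])

theorem jacobiProd_eq_sum (A B : VertexOperator ℂ W) (l m n : ℤ) (w : W) {K : ℕ}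
    (hK : ∀ i : ℕ, K ≤ i → (ncoeff B (n + i)) w = 0) :
    jacobiProd A B l m n w = ∑ i ∈ Finset.range K,
      ((-1 : ℤ) ^ i * Ring.choose l i) • (ncoeff A (l + m - i)) ((ncoeff B (n + i)) w) := by
  refine finsum_eq_sum_of_support_subset _ fun i hi => ?_
  rw [Finset.mem_coe, Finset.mem_range]
  by_contra h
  exact hi (by simp only [hK i (not_lt.mp h), map_zero, smul_zero])

theorem jacobiRevProd_eq_jacobiProd (A B : VertexOperator ℂ W) (l m n : ℤ) (w : W) :
    jacobiRevProd A B l m n w = l.negOnePow • jacobiProd B A l n m w := by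
  rw [jacobiRevProd, jacobiProd, Units.smul_def, smul_finsum' _ (jacobi_support_finite B A _ m w _)]
  exact finsum_congr fun i => by rw [smul_smul, mul_assoc]

/-- `jacobiProd` as a trilinear map. -/
def jacobiProdLin (l m n : ℤ) :
    VertexOperator ℂ W →ₗ[ℂ] VertexOperator ℂ W →ₗ[ℂ] Module.End ℂ W :=
  LinearMap.mk₂ ℂ
    (fun A B =>
      { toFun := jacobiProd A B l m n
        map_add' := fun w w' => by
          simp only [jacobiProd, map_add, smul_add]
          exact finsum_add_distrib (jacobi_support_finite A B _ n w _)
            (jacobi_support_finite A B _ n w' _)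
        map_smul' := fun r w => by
          simp only [jacobiProd, map_smul, RingHom.id_apply]
          rw [smul_finsum' r (jacobi_support_finite A B _ n w _)]
          exact finsum_congr fun i => smul_comm _ _ _ })
    (fun A A' B => LinearMap.ext fun w => by
      simp only [LinearMap.coe_mk, AddHom.coe_mk, LinearMap.add_apply, jacobiProd, map_add,
        Pi.add_apply, smul_add]
      exact finsum_add_distrib (jacobi_support_finite A B _ n w _)
        (jacobi_support_finite A' B _ n w _))
    (fun r A B => LinearMap.ext fun w => by
      simp only [LinearMap.coe_mk, AddHom.coe_mk, LinearMap.smul_apply, jacobiProd, map_smul,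
        Pi.smul_apply]
      rw [smul_finsum' r (jacobi_support_finite A B _ n w _)]
      exact finsum_congr fun i => smul_comm _ _ _)
    (fun A B B' => LinearMap.ext fun w => by
      simp only [LinearMap.coe_mk, AddHom.coe_mk, LinearMap.add_apply, jacobiProd, map_add,
        Pi.add_apply, smul_add]
      exact finsum_add_distrib (jacobi_support_finite A B _ n w _)
        (jacobi_support_finite A B' _ n w _))
    (fun r A B => LinearMap.ext fun w => by
      simp only [LinearMap.coe_mk, AddHom.coe_mk, LinearMap.smul_apply, jacobiProd, map_smul,
        Pi.smul_apply]
      rw [smul_finsum' r (jacobi_support_finite A B _ n w _)]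
      exact finsum_congr fun i => smul_comm _ _ _)

/-- The left side of the Jacobi identity as a trilinear map. -/
def jacobiDiff (l m n : ℤ) :
    VertexOperator ℂ W →ₗ[ℂ] VertexOperator ℂ W →ₗ[ℂ] Module.End ℂ W :=
  jacobiProdLin l m n - l.negOnePow • (jacobiProdLin l n m).flip

theorem jacobiDiff_apply (l m n : ℤ) (A B : VertexOperator ℂ W) (w : W) :
    jacobiDiff l m n A B w = jacobiProd A B l m n w - jacobiRevProd A B l m n w := by
  rw [jacobiRevProd_eq_jacobiProd]
  rfl

theorem jacobiProd_eq_zero_of_le (A B : VertexOperator ℂ W) (l m : ℤ) (w : W) :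
    ∃ N : ℤ, ∀ n, N ≤ n → jacobiProd A B l m n w = 0 := by
  obtain ⟨N, hN⟩ := B.exists_ncoeff_eq_zero w
  refine ⟨N, fun n hn => ?_⟩
  rw [jacobiProd_eq_sum A B l m n w (K := 0) fun i _ => hN _ (by omega), Finset.sum_range_zero]

/-- For fixed `n` only finitely many `B_{n+i} w` are nonzero, and each is annihilated by `A_k` for
large `k`; a common bound exists. -/
theorem jacobiProd_eq_zero_of_le' (A B : VertexOperator ℂ W) (l n : ℤ) (w : W) :
    ∃ N : ℤ, ∀ m, N ≤ m → jacobiProd A B l m n w = 0 := by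
  obtain ⟨K, hK⟩ := B.exists_nat_ncoeff_eq_zero n w
  choose N hN using fun i : ℕ => A.exists_ncoeff_eq_zero ((ncoeff B (n + i)) w)
  obtain ⟨M, hM⟩ := ((Finset.range K).image fun i : ℕ => N i + i - l).bddAbove
  refine ⟨M, fun m hm => ?_⟩
  rw [jacobiProd_eq_sum A B l m n w hK]
  refine Finset.sum_eq_zero fun i hi => ?_
  have := hM (Finset.mem_coe.mpr (Finset.mem_image_of_mem (fun i : ℕ => N i + i - l) hi))
  rw [hN i _ (by omega), smul_zero]

namespace VertexOperator

theorem nthProd_truncated (l : ℤ) (A B : VertexOperator ℂ W) (w : W) :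
    ∃ N : ℤ, ∀ n, N ≤ n → jacobiDiff l 0 n A B w = 0 := by
  obtain ⟨N, hN⟩ := jacobiProd_eq_zero_of_le A B l 0 w
  obtain ⟨N', hN'⟩ := jacobiProd_eq_zero_of_le' B A l 0 w
  refine ⟨max N N', fun n hn => ?_⟩
  rw [jacobiDiff_apply, jacobiRevProd_eq_jacobiProd, hN n (le_trans (le_max_left _ _) hn),
    hN' n (le_trans (le_max_right _ _) hn), smul_zero, sub_zero]

/-- The `l`-th product `A_l B` of two vertex operators,
`Res_{x₁} ((x₁ - x)^l A(x₁) B(x) - (-x + x₁)^l B(x) A(x₁))`. -/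
def nthProd (l : ℤ) : VertexOperator ℂ W →ₗ[ℂ] VertexOperator ℂ W →ₗ[ℂ] VertexOperator ℂ W :=
  LinearMap.mk₂ ℂ
    (fun A B => ofNCoeff (fun n => jacobiDiff l 0 n A B) (nthProd_truncated l A B))
    (fun A A' B => ncoeff_injective <| funext fun n => by
      rw [map_add, Pi.add_apply]; simp only [ncoeff_ofNCoeff, map_add, LinearMap.add_apply])
    (fun r A B => ncoeff_injective <| funext fun n => by
      rw [map_smul, Pi.smul_apply]; simp only [ncoeff_ofNCoeff, map_smul, LinearMap.smul_apply])
    (fun A B B' => ncoeff_injective <| funext fun n => by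
      rw [map_add, Pi.add_apply]; simp only [ncoeff_ofNCoeff, map_add])
    (fun r A B => ncoeff_injective <| funext fun n => by
      rw [map_smul, Pi.smul_apply]; simp only [ncoeff_ofNCoeff, map_smul])

@[simp]
theorem ncoeff_nthProd (l n : ℤ) (A B : VertexOperator ℂ W) :
    (ncoeff (nthProd l A B) n) = jacobiDiff l 0 n A B :=
  ncoeff_ofNCoeff _ _ n

/-- Two vertex operators `A`, `B` are mutually local if `(x₁ - x₂)^l [A(x₁), B(x₂)] = 0` for
sufficiently large `l`. -/
def IsLocal (A B : VertexOperator ℂ W) : Prop :=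
  ∃ N : ℤ, ∀ l m n, N ≤ l → jacobiDiff l m n A B = 0

theorem jacobiDiff_swap (l m n : ℤ) (A B : VertexOperator ℂ W) :
    jacobiDiff l m n A B = -(l.negOnePow • jacobiDiff l n m B A) := by
  simp only [jacobiDiff, LinearMap.sub_apply, LinearMap.smul_apply, LinearMap.flip_apply, smul_sub,
    smul_smul, Int.units_mul_self, one_smul, neg_sub]

theorem IsLocal.symm {A B : VertexOperator ℂ W} (h : IsLocal A B) : IsLocal B A := by
  obtain ⟨N, hN⟩ := h
  exact ⟨N, fun l m n hl => by rw [jacobiDiff_swap, hN l n m hl, smul_zero, neg_zero]⟩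

/-- The vertex operators local with `A` form a subspace. -/
def localSubmodule (A : VertexOperator ℂ W) : Submodule ℂ (VertexOperator ℂ W) where
  carrier := {B | IsLocal A B}
  zero_mem' := ⟨0, fun _ _ _ _ => map_zero _⟩
  add_mem' := by
    rintro B C ⟨N, hN⟩ ⟨N', hN'⟩
    refine ⟨max N N', fun l m n hl => ?_⟩
    rw [map_add, hN l m n (le_trans (le_max_left _ _) hl),
      hN' l m n (le_trans (le_max_right _ _) hl), add_zero]
  smul_mem' := by
    rintro r B ⟨N, hN⟩
    exact ⟨N, fun l m n hl => by rw [map_smul, hN l m n hl, smul_zero]⟩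

end VertexOperator

open VertexOperator

/-- The link between lattice expansions and products of fields. The factors `φ` and `c` leave room
for a third field to the left or to the right, whose index the expansion does not move. -/
theorem binExp_eq_jacobiProd {G : Type*} [AddCommGroup G] (A B : VertexOperator ℂ W)
    {x y : G} {p q : G → ℤ} {φ : G → Module.End ℂ W} {c : G → W}
    (hp : ∀ v (i j : ℤ), p (v + i • x + j • y) = p v + i)
    (hq : ∀ v (i j : ℤ), q (v + i • x + j • y) = q v + j)
    (hφ : ∀ v (i j : ℤ), φ (v + i • x + j • y) = φ v)
    (hc : ∀ v (i j : ℤ), c (v + i • x + j • y) = c v) (l : ℤ) (v : G) :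
    binExp 1 x y l (fun u => φ u ((ncoeff A (p u)) ((ncoeff B (q u)) (c u)))) v =
      φ v (jacobiProd A B l (p v) (q v) (c v)) := by
  rw [jacobiProd]
  erw [(φ v).toAddMonoidHom.map_finsum (jacobi_support_finite A B _ (q v) (c v) _)]
  refine finsum_congr fun i => ?_
  beta_reduce
  rw [hp, hq, hφ, hc, one_zpow, Units.val_one, one_mul, add_sub_left_comm, ← add_sub_assoc]
  exact (map_zsmul (φ v) _ _).symm

theorem binExp_eq_jacobiRevProd {G : Type*} [AddCommGroup G] (A B : VertexOperator ℂ W)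
    {x y : G} {p q : G → ℤ} {φ : G → Module.End ℂ W} {c : G → W}
    (hp : ∀ v (i j : ℤ), p (v + i • y + j • x) = p v + j)
    (hq : ∀ v (i j : ℤ), q (v + i • y + j • x) = q v + i)
    (hφ : ∀ v (i j : ℤ), φ (v + i • y + j • x) = φ v)
    (hc : ∀ v (i j : ℤ), c (v + i • y + j • x) = c v) (l : ℤ) (v : G) :
    binExp (-1) y x l (fun u => φ u ((ncoeff B (q u)) ((ncoeff A (p u)) (c u)))) v =
      φ v (jacobiRevProd A B l (p v) (q v) (c v)) := by
  rw [jacobiRevProd]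
  erw [(φ v).toAddMonoidHom.map_finsum (jacobi_support_finite B A _ (p v) (c v) _)]
  refine finsum_congr fun i => ?_
  beta_reduce
  rw [hp, hq, hφ, hc, add_sub_left_comm, ← add_sub_assoc]
  exact (map_zsmul (φ v) _ _).symm

/-- Both expansions of `(x₁ - x₂)^l` acquire a factor `x₁ - x₂` when `l` grows by one. The reversed
product is a signed product with `m` and `n` interchanged, and the sign change of `l + 1` undoes the
interchange. -/
theorem jacobiDiff_cocycle (A B : VertexOperator ℂ W) (w : W) :
    BinomialCocycle fun l m n => jacobiDiff l m n A B w := by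
  have hrec : ∀ (A B : VertexOperator ℂ W) (l m n : ℤ), jacobiProd A B (l + 1) m n w =
      jacobiProd A B l (m + 1) n w - jacobiProd A B l m (n + 1) w := by
    intro A B l m n
    have key := fun l => binExp_eq_jacobiProd A B (x := ((1, 0) : ℤ × ℤ)) (y := (0, 1))
      (p := Prod.fst) (q := Prod.snd) (φ := fun _ => LinearMap.id) (c := fun _ => w)
      (by simp) (by simp) (by simp) (by simp) l
    have h := binExp_succ 1 (x := ((1, 0) : ℤ × ℤ)) (y := (0, 1)) l
      (f := fun u => (ncoeff A (u.1)) ((ncoeff B (u.2)) w)) (fun v => by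
        obtain ⟨K, hK⟩ := B.exists_nat_ncoeff_eq_zero v.2 w
        refine (Set.finite_Iio K).subset fun i hi => ?_
        by_contra h
        exact hi (by simp [hK i (not_lt.mp h)])) (m, n)
    simpa using ((key _ _).symm.trans h).trans (congrArg _ (congrArg₂ _ (key _ _) (key _ _)))
  intro l m n
  simp only [jacobiDiff_apply, jacobiRevProd_eq_jacobiProd, hrec, Int.negOnePow_succ, smul_sub,
    Units.neg_smul]
  abel

/-- The Jacobi identity for mutually local vertex operators. -/
theorem VertexOperator.IsLocal.jacobiDiff_eq_finsum {A B : VertexOperator ℂ W} (h : IsLocal A B)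
    (l m n : ℤ) (w : W) :
    jacobiDiff l m n A B w =
      ∑ᶠ i : ℕ, (Ring.choose m i) • (ncoeff (nthProd (l + i) A B) (m + n - i)) w := by
  obtain ⟨N, hN⟩ := h
  simpa using (jacobiDiff_cocycle A B w).eq_finsum_choose (N := N)
    (fun l m n hl => by rw [hN l m n hl, LinearMap.zero_apply]) l m n

end NthProducts

/-! ### Expansions applied to products of three fields. -/

section ThreeFields

open VertexOperator

/-- The exponent of the variable with index `a`. -/
abbrev axis (a : Fin 3) : Fin 3 → ℤ := Pi.single a 1

variable {M : Type*} [AddCommGroup M]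

/-- `E l` is the expansion of `(x_a - x_b)^l` in one of the two possible ways, the smaller of the
two variables being reached from the larger one in a direction of the cone spanned by `α`, `β`. -/
def IsDiffExp (α β : Fin 3 → ℤ) (a b : Fin 3)
    (E : ℤ → ((Fin 3 → ℤ) → M) → (Fin 3 → ℤ) → M) : Prop :=
  (E = binExp 1 (axis a) (axis b) ∧ InCone α β (axis b - axis a)) ∨
    (E = binExp (-1) (axis b) (axis a) ∧ InCone α β (axis a - axis b))

section IsDiffExp

variable {α β : Fin 3 → ℤ} {a b c d : Fin 3} {f : (Fin 3 → ℤ) → M}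
  {E E' E'' : ℤ → ((Fin 3 → ℤ) → M) → (Fin 3 → ℤ) → M}

theorem IsDiffExp.coneFinite (hE : IsDiffExp α β a b E) (hf : ConeFinite α β f) (l : ℤ) :
    ConeFinite α β (E l f) := by
  rcases hE with ⟨rfl, h⟩ | ⟨rfl, h⟩ <;> exact hf.binExp h _ _

theorem IsDiffExp.comm (hE : IsDiffExp α β a b E) (hE' : IsDiffExp α β c d E')
    (hf : ConeFinite α β f) (l m : ℤ) : E l (E' m f) = E' m (E l f) := by
  rcases hE with ⟨rfl, h⟩ | ⟨rfl, h⟩ <;> rcases hE' with ⟨rfl, h'⟩ | ⟨rfl, h'⟩ <;>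
    exact hf.binExp_comm h h' _ _ _ _

theorem IsDiffExp.succ (hE : IsDiffExp α β a b E) (hf : ConeFinite α β f) (l : ℤ)
    (v : Fin 3 → ℤ) : E (l + 1) f v = E l f (v + axis a) - E l f (v + axis b) := by
  rcases hE with ⟨rfl, h⟩ | ⟨rfl, h⟩
  · rw [binExp_succ _ _ (hf.rayFinite h), one_smul]
  · rw [binExp_succ _ _ (hf.rayFinite h), Units.neg_smul, one_smul, neg_sub]

theorem IsDiffExp.translate_sub (hE : IsDiffExp α β a b E) (hf : ConeFinite α β f) (l : ℤ)
    (s t v : Fin 3 → ℤ) :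
    E l (fun u => f (u + s) - f (u + t)) v = E l f (v + s) - E l f (v + t) := by
  rcases hE with ⟨rfl, h⟩ | ⟨rfl, h⟩ <;>
  rw [binExp_sub _ _ ((hf.translate s).rayFinite h) ((hf.translate t).rayFinite h),
    binExp_translate, binExp_translate]

/-- This is `x_a - x_b = (x_a - x_c) - (x_b - x_c)`: a further factor is a difference of translates,
and expansions commute with translation. Finiteness on the cone makes the iterated expansions
legitimate. -/
theorem IsDiffExp.cocycle (h12 : IsDiffExp α β a b E) (h13 : IsDiffExp α β a c E')
    (h23 : IsDiffExp α β b c E'') (hf : ConeFinite α β f) (v : Fin 3 → ℤ) :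
    BinomialCocycle fun l m n => E l (E' m (E'' n f)) v := by
  intro l m n
  have c23 := h23.coneFinite hf n
  have c13 := h13.coneFinite c23 m
  have e13 : E' (m + 1) (E'' n f) = fun u =>
      E' m (E'' n f) (u + axis a) - E' m (E'' n f) (u + axis c) :=
    funext fun u => h13.succ c23 m u
  have e23 : E'' (n + 1) f = fun u => E'' n f (u + axis b) - E'' n f (u + axis c) :=
    funext fun u => h23.succ hf n u
  have e123 : E' m (E'' (n + 1) f) = fun u =>
      E' m (E'' n f) (u + axis b) - E' m (E'' n f) (u + axis c) :=
    funext fun u => by rw [e23, h13.translate_sub c23]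
  simp only [e13, e123, h12.translate_sub c13, h12.succ c13]
  abel

end IsDiffExp

variable {W : Type*} [AddCommGroup W] [Module ℂ W]

/-- The coefficients of `A(x_a) B(x_b) C(x_c) w`. -/
def word (A B C : VertexOperator ℂ W) (a b c : Fin 3) (w : W) (v : Fin 3 → ℤ) : W :=
  ncoeff A (v a) (ncoeff B (v b) (ncoeff C (v c) w))

/-- The cone shifts exponents to the right in the word. The index of `C` grows with `j`, which
bounds `j`; for each such `j` the index of `B` grows with `i`, which bounds `i`. -/
theorem word_coneFinite (A B C : VertexOperator ℂ W) {a b c : Fin 3} (hab : a ≠ b) (hac : a ≠ c)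
    (hbc : b ≠ c) (w : W) :
    ConeFinite (axis b - axis a) (axis c - axis b) (word A B C a b c w) := by
  intro v
  obtain ⟨K, hK⟩ := C.exists_nat_ncoeff_eq_zero (v c) w
  choose L hL using fun j : ℕ =>
    B.exists_nat_ncoeff_eq_zero (v b - j) (ncoeff C (v c + j) w)
  refine ((Set.finite_Iio K).biUnion fun j _ =>
    ((Set.finite_Iio (L j)).prod (Set.finite_singleton j))).subset ?_
  rintro ⟨i, j⟩ hij
  have hj : j < K := by
    by_contra h
    refine hij ?_
    simp [word, hac.symm, hbc.symm, hK j (not_lt.mp h)]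
  refine Set.mem_biUnion hj ⟨?_, rfl⟩
  by_contra h
  refine hij ?_
  have := hL j i (not_lt.mp h)
  rw [sub_add_eq_add_sub] at this
  simp [word, hac.symm, hbc.symm, hab.symm, hbc, ← sub_eq_add_neg, this]

theorem inCone_left (α β : Fin 3 → ℤ) : InCone α β α := ⟨1, 0, by simp, by simp⟩

theorem inCone_right (α β : Fin 3 → ℤ) : InCone α β β := ⟨0, 1, by simp, by simp⟩

theorem inCone_outer (a b c : Fin 3) :
    InCone (axis b - axis a) (axis c - axis b) (axis c - axis a) :=
  ⟨1, 1, by simp, by simp⟩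

variable (a b c : Fin 3)

/-- The expansions of powers of `x_a - x_b` for `|x_a| > |x_b|`. -/
abbrev fwdExp (a b : Fin 3) (l : ℤ) (f : (Fin 3 → ℤ) → M) : (Fin 3 → ℤ) → M :=
  binExp 1 (axis a) (axis b) l f

/-- The expansions of powers of `x_a - x_b` for `|x_b| > |x_a|`. -/
abbrev revExp (a b : Fin 3) (l : ℤ) (f : (Fin 3 → ℤ) → M) : (Fin 3 → ℤ) → M :=
  binExp (-1) (axis b) (axis a) l f

section Orders

theorem isDiffExp_fwd_left :
    IsDiffExp (axis b - axis a) (axis c - axis b) a b (fwdExp (M := M) a b) :=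
  Or.inl ⟨rfl, inCone_left _ _⟩

theorem isDiffExp_fwd_right :
    IsDiffExp (axis b - axis a) (axis c - axis b) b c (fwdExp (M := M) b c) :=
  Or.inl ⟨rfl, inCone_right _ _⟩

theorem isDiffExp_fwd_outer :
    IsDiffExp (axis b - axis a) (axis c - axis b) a c (fwdExp (M := M) a c) :=
  Or.inl ⟨rfl, inCone_outer _ _ _⟩

theorem isDiffExp_rev_left :
    IsDiffExp (axis b - axis a) (axis c - axis b) b a (revExp (M := M) b a) :=
  Or.inr ⟨rfl, inCone_left _ _⟩

theorem isDiffExp_rev_right :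
    IsDiffExp (axis b - axis a) (axis c - axis b) c b (revExp (M := M) c b) :=
  Or.inr ⟨rfl, inCone_right _ _⟩

theorem isDiffExp_rev_outer :
    IsDiffExp (axis b - axis a) (axis c - axis b) c a (revExp (M := M) c a) :=
  Or.inr ⟨rfl, inCone_outer _ _ _⟩

end Orders

variable {a b c} (A B C : VertexOperator ℂ W)

section Adjacent

theorem fwdExp_word_left (hab : a ≠ b) (hac : a ≠ c) (hbc : b ≠ c) (w : W) (l : ℤ)
    (v : Fin 3 → ℤ) :
    fwdExp a b l (word A B C a b c w) v =
      jacobiProd A B l (v a) (v b) (ncoeff C (v c) w) := by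
  have h := binExp_eq_jacobiProd A B (x := axis a) (y := axis b) (p := fun v => v a)
    (q := fun v => v b) (φ := fun _ => LinearMap.id) (c := fun v => ncoeff C (v c) w)
    (by simp [hab]) (by simp [hab.symm])
    (by simp) (by simp [hac.symm, hbc.symm]) l v
  simp only [LinearMap.id_apply] at h
  exact h

theorem revExp_word_left (hab : a ≠ b) (hac : a ≠ c) (hbc : b ≠ c) (w : W) (l : ℤ)
    (v : Fin 3 → ℤ) :
    revExp a b l (word B A C b a c w) v =
      jacobiRevProd A B l (v a) (v b) (ncoeff C (v c) w) := by
  have h := binExp_eq_jacobiRevProd A B (x := axis a) (y := axis b) (p := fun v => v a)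
    (q := fun v => v b) (φ := fun _ => LinearMap.id) (c := fun v => ncoeff C (v c) w)
    (by simp [hab]) (by simp [hab.symm])
    (by simp) (by simp [hac.symm, hbc.symm]) l v
  simp only [LinearMap.id_apply] at h
  exact h

theorem fwdExp_word_right (hab : a ≠ b) (hac : a ≠ c) (hbc : b ≠ c) (w : W) (l : ℤ)
    (v : Fin 3 → ℤ) :
    fwdExp a b l (word C A B c a b w) v =
      ncoeff C (v c) (jacobiProd A B l (v a) (v b) w) := by
  have h := binExp_eq_jacobiProd A B (x := axis a) (y := axis b) (p := fun v => v a)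
    (q := fun v => v b) (φ := fun v => ncoeff C (v c)) (c := fun _ => w)
    (by simp [hab]) (by simp [hab.symm])
    (by simp [hac.symm, hbc.symm]) (by simp) l v
  exact h

theorem revExp_word_right (hab : a ≠ b) (hac : a ≠ c) (hbc : b ≠ c) (w : W) (l : ℤ)
    (v : Fin 3 → ℤ) :
    revExp a b l (word C B A c b a w) v =
      ncoeff C (v c) (jacobiRevProd A B l (v a) (v b) w) := by
  have h := binExp_eq_jacobiRevProd A B (x := axis a) (y := axis b) (p := fun v => v a)
    (q := fun v => v b) (φ := fun v => ncoeff C (v c)) (c := fun _ => w)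
    (by simp [hab]) (by simp [hab.symm])
    (by simp [hac.symm, hbc.symm]) (by simp) l v
  exact h

end Adjacent

end ThreeFields

/-! ### Nested products of three fields: commutator and associator formulas, and Dong's lemma. -/

section NestedProducts

open VertexOperator

variable {W : Type*} [AddCommGroup W] [Module ℂ W]

theorem fwdExp_eq_smul_revExp {M : Type*} [AddCommGroup M] (a b : Fin 3) (l : ℤ)
    (f : (Fin 3 → ℤ) → M) (v : Fin 3 → ℤ) :
    fwdExp b a l f v = l.negOnePow • revExp a b l f v := by
  change binExp 1 _ _ _ _ _ = ((-1 : ℤˣ) ^ l) • binExp (-1) _ _ _ _ _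
  rcases Int.units_eq_one_or ((-1 : ℤˣ) ^ l) with h | h
  · simp only [binExp, h, one_zpow, one_smul]
  · simp only [binExp, h, one_zpow, Units.neg_smul, one_smul, ← finsum_neg_distrib, ← neg_smul,
      Units.val_one, Units.val_neg, one_mul, neg_mul, neg_neg]

theorem revExp_eq_smul_fwdExp {M : Type*} [AddCommGroup M] (a b : Fin 3) (l : ℤ)
    (f : (Fin 3 → ℤ) → M) (v : Fin 3 → ℤ) :
    revExp b a l f v = l.negOnePow • fwdExp a b l f v := by
  rw [fwdExp_eq_smul_revExp, smul_smul, Int.units_mul_self, one_smul]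

/-- The residues giving the nested products `A_m (B_n C)`, multiplied by `(x_a - x_b)^l`. -/
def nestedRes (A B C : VertexOperator ℂ W) (a b c : Fin 3) (w : W) (v : Fin 3 → ℤ)
    (l m n : ℤ) : W :=
  fwdExp a b l (fwdExp a c m (fwdExp b c n (word A B C a b c w))) v -
      fwdExp a b l (fwdExp a c m (revExp b c n (word A C B a c b w))) v -
    (revExp a b l (revExp a c m (fwdExp b c n (word B C A b c a w))) v -
      revExp a b l (revExp a c m (revExp b c n (word C B A c b a w))) v)

/-- The residues giving the nested products `(A_l B)_n C`, multiplied by `(x_a - x_c)^m`. -/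
def compRes (A B C : VertexOperator ℂ W) (a b c : Fin 3) (w : W) (v : Fin 3 → ℤ)
    (l m n : ℤ) : W :=
  fwdExp a b l (fwdExp a c m (fwdExp b c n (word A B C a b c w))) v -
      revExp a b l (fwdExp a c m (fwdExp b c n (word B A C b a c w))) v -
    (fwdExp a b l (revExp a c m (revExp b c n (word C A B c a b w))) v -
      revExp a b l (revExp a c m (revExp b c n (word C B A c b a w))) v)

variable {a b c : Fin 3} {A B C : VertexOperator ℂ W}

theorem jacobiProd_eq_of_jacobiDiff_eq_zero {l m n : ℤ} (h : jacobiDiff l m n A B = 0) (w : W) :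
    jacobiProd A B l m n w = jacobiRevProd A B l m n w := by
  rw [← sub_eq_zero, ← jacobiDiff_apply, h, LinearMap.zero_apply]

/-- The form in which locality is used: the weight `(x_a - x_b)^l` allows adjacent `A` and `B` to
change places. -/
theorem fwdExp_word_left_eq_revExp (hab : a ≠ b) (hac : a ≠ c) (hbc : b ≠ c) {l : ℤ}
    (h : ∀ m n, jacobiDiff l m n A B = 0) (C : VertexOperator ℂ W) (w : W) :
    fwdExp a b l (word A B C a b c w) = revExp a b l (word B A C b a c w) := funext fun v => by
  rw [fwdExp_word_left A B C hab hac hbc, revExp_word_left A B C hab hac hbc,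
    jacobiProd_eq_of_jacobiDiff_eq_zero (h _ _)]

theorem fwdExp_word_right_eq_revExp (hab : a ≠ b) (hac : a ≠ c) (hbc : b ≠ c) {l : ℤ}
    (h : ∀ m n, jacobiDiff l m n A B = 0) (C : VertexOperator ℂ W) (w : W) :
    fwdExp a b l (word C A B c a b w) = revExp a b l (word C B A c b a w) := funext fun v => by
  rw [fwdExp_word_right A B C hab hac hbc, revExp_word_right A B C hab hac hbc,
    jacobiProd_eq_of_jacobiDiff_eq_zero (h _ _)]

section

variable (A B C)

/-- In each of the four words every difference is expanded with the variable of the field further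
left as the larger one, so all expansions fit the cone of that word. -/
theorem nestedRes_cocycle (hab : a ≠ b) (hac : a ≠ c) (hbc : b ≠ c) (w : W) (v : Fin 3 → ℤ) :
    BinomialCocycle (nestedRes A B C a b c w v) :=
  (((isDiffExp_fwd_left a b c).cocycle (isDiffExp_fwd_outer a b c) (isDiffExp_fwd_right a b c)
      (word_coneFinite A B C hab hac hbc w) v).sub
    ((isDiffExp_fwd_outer a c b).cocycle (isDiffExp_fwd_left a c b) (isDiffExp_rev_right a c b)
      (word_coneFinite A C B hac hab hbc.symm w) v)).sub
  (((isDiffExp_rev_outer b c a).cocycle (isDiffExp_rev_right b c a) (isDiffExp_fwd_left b c a)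
      (word_coneFinite B C A hbc hab.symm hac.symm w) v).sub
    ((isDiffExp_rev_right c b a).cocycle (isDiffExp_rev_outer c b a) (isDiffExp_rev_left c b a)
      (word_coneFinite C B A hbc.symm hac.symm hab.symm w) v))

theorem compRes_cocycle (hab : a ≠ b) (hac : a ≠ c) (hbc : b ≠ c) (w : W) (v : Fin 3 → ℤ) :
    BinomialCocycle (compRes A B C a b c w v) :=
  (((isDiffExp_fwd_left a b c).cocycle (isDiffExp_fwd_outer a b c) (isDiffExp_fwd_right a b c)
      (word_coneFinite A B C hab hac hbc w) v).sub
    ((isDiffExp_rev_left b a c).cocycle (isDiffExp_fwd_right b a c) (isDiffExp_fwd_outer b a c)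
      (word_coneFinite B A C hab.symm hbc hac w) v)).sub
  (((isDiffExp_fwd_right c a b).cocycle (isDiffExp_rev_left c a b) (isDiffExp_rev_outer c a b)
      (word_coneFinite C A B hac.symm hbc.symm hab w) v).sub
    ((isDiffExp_rev_right c b a).cocycle (isDiffExp_rev_outer c b a) (isDiffExp_rev_left c b a)
      (word_coneFinite C B A hbc.symm hac.symm hab.symm w) v))

/-- A weighted form of `[[A, B], C] = [A, [B, C]] - [B, [A, C]]`. The words `A C B` and `B C A`
cancel; the sign comes from `(x_b - x_a)^l = (-1)^l (x_a - x_b)^l`. -/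
theorem compRes_eq_nestedRes_sub (hab : a ≠ b) (hac : a ≠ c) (hbc : b ≠ c) (w : W)
    (v : Fin 3 → ℤ) (l m n : ℤ) :
    compRes A B C a b c w v l m n =
      nestedRes A B C a b c w v l m n - l.negOnePow • nestedRes B A C b a c w v l n m := by
  have h1 := (isDiffExp_fwd_outer b a c).comm (isDiffExp_fwd_right b a c)
    (word_coneFinite B A C hab.symm hbc hac w) n m
  have h2 := (isDiffExp_fwd_left b c a).comm (isDiffExp_rev_right b c a)
    (word_coneFinite B C A hbc hab.symm hac.symm w) n m
  have h3 := (isDiffExp_rev_right a c b).comm (isDiffExp_fwd_left a c b)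
    (word_coneFinite A C B hac hab hbc.symm w) n m
  have h4 := (isDiffExp_rev_outer c a b).comm (isDiffExp_rev_left c a b)
    (word_coneFinite C A B hac.symm hbc.symm hab w) n m
  simp only [compRes, nestedRes]
  rw [h1, h2, h3, h4]
  simp only [fwdExp_eq_smul_revExp a b, revExp_eq_smul_fwdExp a b, smul_sub, smul_smul,
    Int.units_mul_self, one_smul]
  abel

theorem nestedRes_eq_zero (hab : a ≠ b) (hac : a ≠ c) (hbc : b ≠ c) (w : W) (v : Fin 3 → ℤ)
    (l m : ℤ) {n : ℤ} (h : ∀ p q, jacobiDiff n p q B C = 0) :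
    nestedRes A B C a b c w v l m n = 0 := by
  rw [nestedRes, fwdExp_word_left_eq_revExp hbc hab.symm hac.symm h,
    fwdExp_word_right_eq_revExp hbc hab.symm hac.symm h, sub_self, sub_self, sub_self]

/-- `A` and `B` are adjacent in all four words, so `(x_a - x_b)^l` can be commuted inwards to
exchange them. -/
theorem compRes_eq_zero (hab : a ≠ b) (hac : a ≠ c) (hbc : b ≠ c) (w : W) (v : Fin 3 → ℤ)
    (m n : ℤ) {l : ℤ} (h : ∀ p q, jacobiDiff l p q A B = 0) :
    compRes A B C a b c w v l m n = 0 := by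
  have c1 := word_coneFinite A B C hab hac hbc w
  have c2 := word_coneFinite B A C hab.symm hbc hac w
  have c3 := word_coneFinite C A B hac.symm hbc.symm hab w
  have c4 := word_coneFinite C B A hbc.symm hac.symm hab.symm w
  rw [compRes,
    (isDiffExp_fwd_left a b c).comm (isDiffExp_fwd_outer a b c)
      ((isDiffExp_fwd_right a b c).coneFinite c1 n),
    (isDiffExp_fwd_left a b c).comm (isDiffExp_fwd_right a b c) c1,
    (isDiffExp_rev_left b a c).comm (isDiffExp_fwd_right b a c)
      ((isDiffExp_fwd_outer b a c).coneFinite c2 n),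
    (isDiffExp_rev_left b a c).comm (isDiffExp_fwd_outer b a c) c2,
    (isDiffExp_fwd_right c a b).comm (isDiffExp_rev_left c a b)
      ((isDiffExp_rev_outer c a b).coneFinite c3 n),
    (isDiffExp_fwd_right c a b).comm (isDiffExp_rev_outer c a b) c3,
    (isDiffExp_rev_right c b a).comm (isDiffExp_rev_outer c b a)
      ((isDiffExp_rev_left c b a).coneFinite c4 n),
    (isDiffExp_rev_right c b a).comm (isDiffExp_rev_left c b a) c4,
    fwdExp_word_left_eq_revExp hab hac hbc h, fwdExp_word_right_eq_revExp hab hac hbc h,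
    sub_self, sub_self, sub_self]

/-- The two weights let `C` pass both `A` and `B`: `A B C` turns into `C A B` and `B A C` into `C B
A`, and the terms cancel in pairs. -/
theorem compRes_eq_zero_of_outer (hab : a ≠ b) (hac : a ≠ c) (hbc : b ≠ c) (w : W)
    (v : Fin 3 → ℤ) (l : ℤ) {m n : ℤ} (h13 : ∀ p q, jacobiDiff m p q A C = 0)
    (h23 : ∀ p q, jacobiDiff n p q B C = 0) :
    compRes A B C a b c w v l m n = 0 := by
  have c1 := word_coneFinite A C B hac hab hbc.symm w
  have c2 := word_coneFinite C A B hac.symm hbc.symm hab w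
  have c3 := word_coneFinite B A C hab.symm hbc hac w
  have c4 := word_coneFinite B C A hbc hab.symm hac.symm w
  rw [compRes, fwdExp_word_right_eq_revExp hbc hab.symm hac.symm h23 A w,
    (isDiffExp_fwd_left a c b).comm (isDiffExp_rev_right a c b) c1,
    fwdExp_word_left_eq_revExp hac hab hbc.symm h13 B w,
    (isDiffExp_rev_outer c a b).comm (isDiffExp_rev_left c a b) c2,
    (isDiffExp_fwd_right b a c).comm (isDiffExp_fwd_outer b a c) c3,
    fwdExp_word_right_eq_revExp hac hab hbc.symm h13 B w,
    (isDiffExp_fwd_left b c a).comm (isDiffExp_rev_right b c a) c4,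
    fwdExp_word_left_eq_revExp hbc hab.symm hac.symm h23 A w, sub_self]

/-- The zero entries of the exponent vector at `a` and `b` express the two residues. The outer
expansion moves only the `a` and `c` entries, so the inner residue is still taken at exponent zero,
as `nthProd` requires. -/
theorem nestedRes_zero (hab : a ≠ b) (hac : a ≠ c) (hbc : b ≠ c) (w : W) (m n k : ℤ) :
    nestedRes A B C a b c w (Pi.single c k) 0 m n =
      ncoeff (nthProd m A (nthProd n B C)) k w := by
  set v : Fin 3 → ℤ := Pi.single c k with hv
  have hD : ∀ (i j : ℤ) (x y : Fin 3), (x = a ∧ y = c ∨ x = c ∧ y = a) →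
      ∀ w', ncoeff (nthProd n B C) ((v + i • axis x + j • axis y) c) w' =
      jacobiProd B C n ((v + i • axis x + j • axis y) b) ((v + i • axis x + j • axis y) c) w' -
      jacobiRevProd B C n ((v + i • axis x + j • axis y) b)
        ((v + i • axis x + j • axis y) c) w' := by
    intro i j x y hxy w'
    have : (v + i • axis x + j • axis y) b = 0 := by
      rcases hxy with ⟨rfl, rfl⟩ | ⟨rfl, rfl⟩ <;> simp [hv, hab.symm, hbc]
    rw [this, ncoeff_nthProd, jacobiDiff_apply]
  have e1 := binExp_eq_jacobiProd A (nthProd n B C) (x := axis a) (y := axis c)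
    (p := fun v => v a) (q := fun v => v c) (φ := fun _ => LinearMap.id) (c := fun _ => w)
    (by simp [hac]) (by simp [hac.symm]) (by simp) (by simp) m v
  have e2 := binExp_eq_jacobiRevProd A (nthProd n B C) (x := axis a) (y := axis c)
    (p := fun v => v a) (q := fun v => v c) (φ := fun _ => LinearMap.id) (c := fun _ => w)
    (by simp [hac]) (by simp [hac.symm]) (by simp) (by simp) m v
  have f1 : fwdExp a c m (fun u => ncoeff A (u a) (ncoeff (nthProd n B C) (u c) w)) v =
      fwdExp a c m (fun u => fwdExp b c n (word A B C a b c w) u -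
        revExp b c n (word A C B a c b w) u) v := by
    refine binExp_congr fun i => ?_
    rw [hD _ _ _ _ (Or.inl ⟨rfl, rfl⟩), map_sub,
      fwdExp_word_right B C A hbc hab.symm hac.symm,
      revExp_word_right B C A hbc hab.symm hac.symm]
  have f2 : revExp a c m (fun u => ncoeff (nthProd n B C) (u c) (ncoeff A (u a) w)) v =
      revExp a c m (fun u => fwdExp b c n (word B C A b c a w) u -
        revExp b c n (word C B A c b a w) u) v := by
    refine binExp_congr fun i => ?_
    rw [hD _ _ _ _ (Or.inr ⟨rfl, rfl⟩),
      fwdExp_word_left B C A hbc hab.symm hac.symm,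
      revExp_word_left B C A hbc hab.symm hac.symm]
  have g1 := binExp_sub 1 m
    (((isDiffExp_fwd_right a b c).coneFinite
      (word_coneFinite A B C hab hac hbc w) n).rayFinite (inCone_outer a b c))
    (((isDiffExp_rev_right a c b).coneFinite
      (word_coneFinite A C B hac hab hbc.symm w) n).rayFinite (inCone_left _ _)) v
  have g2 := binExp_sub (-1) m
    (((isDiffExp_fwd_left b c a).coneFinite
      (word_coneFinite B C A hbc hab.symm hac.symm w) n).rayFinite (inCone_right _ _))
    (((isDiffExp_rev_left c b a).coneFinite
      (word_coneFinite C B A hbc.symm hac.symm hab.symm w) n).rayFinite (inCone_outer c b a)) v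
  have va : v a = 0 := by simp [hv, hac]
  have vc : v c = k := by simp [hv]
  simp only [LinearMap.id_apply, va, vc] at e1 e2
  rw [ncoeff_nthProd, jacobiDiff_apply, e1.symm.trans (f1.trans g1), e2.symm.trans (f2.trans g2)]
  simp only [nestedRes, binExp_zero]

theorem compRes_zero (hab : a ≠ b) (hac : a ≠ c) (hbc : b ≠ c) (w : W) (l n p q : ℤ) :
    compRes A B C a b c w (Pi.single b p + Pi.single c q) l 0 n =
      jacobiDiff n p q (nthProd l A B) C w := by
  set v : Fin 3 → ℤ := Pi.single b p + Pi.single c q with hv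
  have hD : ∀ (i j : ℤ) (x y : Fin 3), (x = b ∧ y = c ∨ x = c ∧ y = b) →
      ∀ w', ncoeff (nthProd l A B) ((v + i • axis x + j • axis y) b) w' =
      jacobiProd A B l ((v + i • axis x + j • axis y) a) ((v + i • axis x + j • axis y) b) w' -
      jacobiRevProd A B l ((v + i • axis x + j • axis y) a)
        ((v + i • axis x + j • axis y) b) w' := by
    intro i j x y hxy w'
    have : (v + i • axis x + j • axis y) a = 0 := by
      rcases hxy with ⟨rfl, rfl⟩ | ⟨rfl, rfl⟩ <;> simp [hv, hab, hac]
    rw [this, ncoeff_nthProd, jacobiDiff_apply]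
  have e1 := binExp_eq_jacobiProd (nthProd l A B) C (x := axis b) (y := axis c)
    (p := fun v => v b) (q := fun v => v c) (φ := fun _ => LinearMap.id) (c := fun _ => w)
    (by simp [hbc]) (by simp [hbc.symm]) (by simp) (by simp) n v
  have e2 := binExp_eq_jacobiRevProd (nthProd l A B) C (x := axis b) (y := axis c)
    (p := fun v => v b) (q := fun v => v c) (φ := fun _ => LinearMap.id) (c := fun _ => w)
    (by simp [hbc]) (by simp [hbc.symm]) (by simp) (by simp) n v
  have f1 : fwdExp b c n (fun u => ncoeff (nthProd l A B) (u b) (ncoeff C (u c) w)) v =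
      fwdExp b c n (fun u => fwdExp a b l (word A B C a b c w) u -
        revExp a b l (word B A C b a c w) u) v := by
    refine binExp_congr fun i => ?_
    rw [hD _ _ _ _ (Or.inl ⟨rfl, rfl⟩),
      fwdExp_word_left A B C hab hac hbc, revExp_word_left A B C hab hac hbc]
  have f2 : revExp b c n (fun u => ncoeff C (u c) (ncoeff (nthProd l A B) (u b) w)) v =
      revExp b c n (fun u => fwdExp a b l (word C A B c a b w) u -
        revExp a b l (word C B A c b a w) u) v := by
    refine binExp_congr fun i => ?_
    rw [hD _ _ _ _ (Or.inr ⟨rfl, rfl⟩), map_sub,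
      fwdExp_word_right A B C hab hac hbc, revExp_word_right A B C hab hac hbc]
  have c1 := word_coneFinite A B C hab hac hbc w
  have c2 := word_coneFinite B A C hab.symm hbc hac w
  have c3 := word_coneFinite C A B hac.symm hbc.symm hab w
  have c4 := word_coneFinite C B A hbc.symm hac.symm hab.symm w
  have g1 := binExp_sub 1 n
    (((isDiffExp_fwd_left a b c).coneFinite c1 l).rayFinite (inCone_right _ _))
    (((isDiffExp_rev_left b a c).coneFinite c2 l).rayFinite (inCone_outer b a c)) v
  have g2 := binExp_sub (-1) n
    (((isDiffExp_fwd_right c a b).coneFinite c3 l).rayFinite (inCone_outer c a b))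
    (((isDiffExp_rev_right c b a).coneFinite c4 l).rayFinite (inCone_left _ _)) v
  have vb : v b = p := by simp [hv, hbc]
  have vc : v c = q := by simp [hv, hbc.symm]
  simp only [LinearMap.id_apply, vb, vc] at e1 e2
  rw [jacobiDiff_apply, e1.symm.trans (f1.trans g1), e2.symm.trans (f2.trans g2)]
  simp only [compRes, binExp_zero]
  rw [(isDiffExp_fwd_left a b c).comm (isDiffExp_fwd_right a b c) c1,
    (isDiffExp_rev_left b a c).comm (isDiffExp_fwd_outer b a c) c2,
    (isDiffExp_fwd_right c a b).comm (isDiffExp_rev_outer c a b) c3,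
    (isDiffExp_rev_right c b a).comm (isDiffExp_rev_left c b a) c4]

end

namespace VertexOperator

/-- The commutator formula for the products of vertex operators. -/
theorem IsLocal.nthProd_commutator (h : IsLocal A B) (C : VertexOperator ℂ W) (m n k : ℤ)
    (w : W) :
    ncoeff (nthProd m A (nthProd n B C)) k w - ncoeff (nthProd n B (nthProd m A C)) k w =
      ∑ᶠ i : ℕ, (Ring.choose m i) • ncoeff (nthProd (m + n - i) (nthProd i A B) C) k w := by
  obtain ⟨N, hN⟩ := h
  have h01 : (0 : Fin 3) ≠ 1 := by decide
  have h02 : (0 : Fin 3) ≠ 2 := by decide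
  have h12 : (1 : Fin 3) ≠ 2 := by decide
  -- At `l = 0` the right side is the commutator of nested products. Locality of `A` and `B` makes
  -- the left side vanish for large `l`, so it expands over its slice `m = 0`, where `compRes_zero`
  -- applies.
  have e := compRes_eq_nestedRes_sub A B C h01 h02 h12 w (Pi.single 2 k) 0 m n
  rw [nestedRes_zero A B C h01 h02 h12, nestedRes_zero B A C h01.symm h12 h02, Int.negOnePow_zero,
    one_smul, (compRes_cocycle A B C h01 h02 h12 w _).eq_finsum_choose (N := N)
      (fun l m n hl => compRes_eq_zero A B C h01 h02 h12 w _ m n fun p q => hN l p q hl)] at e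
  rw [← e]
  refine finsum_congr fun i => ?_
  have := compRes_zero A B C h01 h02 h12 w (0 + i) (m + n - i) 0 k
  rw [Pi.single_zero, zero_add] at this
  rw [this, ncoeff_nthProd, zero_add]

/-- The expression of `(A_l B)_n C` by nested products. -/
theorem nthProd_nthProd (hAC : IsLocal A C) (hBC : IsLocal B C) (l n k : ℤ) (w : W) :
    ncoeff (nthProd n (nthProd l A B) C) k w =
      ∑ᶠ i : ℕ, ((-1 : ℤ) ^ i * Ring.choose l i) •
          ncoeff (nthProd (l - i) A (nthProd (n + i) B C)) k w -
        l.negOnePow • ∑ᶠ i : ℕ, ((-1 : ℤ) ^ i * Ring.choose l i) •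
          ncoeff (nthProd (l + n - i) B (nthProd i A C)) k w := by
  obtain ⟨N, hN⟩ := hAC
  obtain ⟨N', hN'⟩ := hBC
  have h01 : (0 : Fin 3) ≠ 1 := by decide
  have h02 : (0 : Fin 3) ≠ 2 := by decide
  have h12 : (1 : Fin 3) ≠ 2 := by decide
  have e := compRes_zero A B C h01 h02 h12 w l n 0 k
  rw [Pi.single_zero, zero_add, ← ncoeff_nthProd,
    compRes_eq_nestedRes_sub A B C h01 h02 h12,
    (nestedRes_cocycle A B C h01 h02 h12 w _).eq_finsum (N := N')
      (fun l m n hn => nestedRes_eq_zero A B C h01 h02 h12 w _ l m fun p q => hN' n p q hn),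
    (nestedRes_cocycle B A C h01.symm h12 h02 w _).eq_finsum (N := N)
      (fun l m n hn => nestedRes_eq_zero B A C h01.symm h12 h02 w _ l m
        fun p q => hN n p q hn)] at e
  simpa only [nestedRes_zero A B C h01 h02 h12, nestedRes_zero B A C h01.symm h12 h02, add_zero,
    zero_add] using e.symm

/-- Dong's lemma: if `A`, `B`, `C` are mutually local, then so are `A_l B` and `C`. -/
theorem IsLocal.nthProd (hAB : IsLocal A B) (hAC : IsLocal A C) (hBC : IsLocal B C) (l : ℤ) :
    IsLocal (nthProd l A B) C := by
  obtain ⟨N₁, hN₁⟩ := hAB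
  obtain ⟨N₂, hN₂⟩ := hAC
  obtain ⟨N₃, hN₃⟩ := hBC
  have h01 : (0 : Fin 3) ≠ 1 := by decide
  have h02 : (0 : Fin 3) ≠ 2 := by decide
  have h12 : (1 : Fin 3) ≠ 2 := by decide
  -- `s` and `t` bound how far `l` and `m` fall below their locality bounds. The recursion trades
  -- one unit of `n` for one of `l` or `m`; `s = 0` is settled by locality of `A` and `B`, and `t =
  -- 0` by moving `C` past both.
  have key : ∀ (w : W) (v : Fin 3 → ℤ) (s t : ℕ) (l m n : ℤ), N₁ - s ≤ l → N₂ - t ≤ m →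
      N₃ + s + t ≤ n → compRes A B C 0 1 2 w v l m n = 0 := by
    intro w v s t
    induction' hk : s + t with k ih generalizing s t
    all_goals intro l m n hl hm hn
    · exact compRes_eq_zero A B C h01 h02 h12 w v m n fun p q => hN₁ l p q (by omega)
    · rcases Nat.eq_zero_or_pos s with hs | hs
      · exact compRes_eq_zero A B C h01 h02 h12 w v m n fun p q => hN₁ l p q (by omega)
      rcases Nat.eq_zero_or_pos t with ht | ht
      · exact compRes_eq_zero_of_outer A B C h01 h02 h12 w v l (fun p q => hN₂ m p q (by omega))
          fun p q => hN₃ n p q (by omega)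
      have h := compRes_cocycle A B C h01 h02 h12 w v l m (n - 1)
      rw [sub_add_cancel, ih (s - 1) t (by omega) (l + 1) m (n - 1) (by omega) hm (by omega),
        ih s (t - 1) (by omega) l (m + 1) (n - 1) hl (by omega) (by omega), zero_sub,
        zero_eq_neg] at h
      exact h
  -- Here `m = 0`, so the deficit of `m` is the positive part of `N₂`.
  refine ⟨N₃ + (N₁ - l).toNat + N₂.toNat, fun n p q hn => LinearMap.ext fun w => ?_⟩
  rw [← compRes_zero A B C h01 h02 h12, LinearMap.zero_apply]
  exact key w _ (N₁ - l).toNat N₂.toNat _ _ _ (by omega) (by omega) hn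

/-- Two vertex operators with `[A(x₁), B(x₂)] = D(x₂) x₂⁻¹ δ(x₁ / x₂)`. -/
theorem isLocal_of_commutator {D : VertexOperator ℂ W}
    (h : ∀ m n w, ncoeff A m (ncoeff B n w) - ncoeff B n (ncoeff A m w) = ncoeff D (m + n) w) :
    IsLocal A B ∧ nthProd 0 A B = D ∧ ∀ n : ℤ, 0 < n → nthProd n A B = 0 := by
  have h0 : ∀ m n, jacobiDiff 0 m n A B = ncoeff D (m + n) := fun m n => LinearMap.ext fun w => by
    have e : ∀ (A B : VertexOperator ℂ W) (m n : ℤ), jacobiProd A B 0 m n w =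
        ncoeff A m (ncoeff B n w) := fun A B m n => by
      rw [jacobiProd, finsum_eq_single _ 0]
      · simp
      · intro i hi
        rw [Ring.choose_zero_pos ℤ (Nat.pos_of_ne_zero hi), mul_zero, zero_smul]
    rw [jacobiDiff_apply, jacobiRevProd_eq_jacobiProd, e, e, Int.negOnePow_zero, one_smul, h]
  -- At `l = 0` the value depends only on `m + n`, so the recursion cancels at `l = 1`: the factor
  -- `x₁ - x₂` annihilates the delta function.
  have h1 : ∀ l m n, 1 ≤ l → jacobiDiff l m n A B = 0 := by
    intro l m n hl
    induction l, hl using Int.leInduction generalizing m n with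
    | base =>
      refine LinearMap.ext fun w => ?_
      have := jacobiDiff_cocycle A B w 0 m n
      simp only [h0, zero_add] at this
      rw [this, add_right_comm, add_assoc, sub_self, LinearMap.zero_apply]
    | succ l _ ih =>
      refine LinearMap.ext fun w => ?_
      have := jacobiDiff_cocycle A B w l m n
      simp only [ih, LinearMap.zero_apply, sub_self] at this
      rw [this, LinearMap.zero_apply]
  refine ⟨⟨1, h1⟩, ncoeff_injective <| funext fun n => ?_,
    fun n hn => ncoeff_injective <| funext fun k => ?_⟩
  · rw [ncoeff_nthProd, h0, zero_add]
  · rw [ncoeff_nthProd, h1 n 0 k hn, map_zero, Pi.zero_apply]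

end VertexOperator

end NestedProducts

/-! ### Modules for the loop algebra and the universal property of the induced module. -/

namespace LeibnizAlgebra

attribute [local instance 100] LieRing.ofAssociativeRing

section LoopMaps

variable {X M : Type*} [AddCommGroup X] [Module ℂ X] [AddCommGroup M] [Module ℂ M]

/-- The linear map on `X ⊗ ℂ[t, t⁻¹]` with prescribed values on the elements `a ⊗ tⁿ`. -/
def loopLift (φ : ℤ → X →ₗ[ℂ] M) : ℂ[T;T⁻¹] ⊗[ℂ] X →ₗ[ℂ] M :=
  TensorProduct.lift ((AddMonoidAlgebra.basis ℤ ℂ).constr ℂ φ)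

@[simp]
theorem loopLift_T_tmul (φ : ℤ → X →ₗ[ℂ] M) (n : ℤ) (a : X) :
    loopLift φ (LaurentPolynomial.T n ⊗ₜ a) = φ n a := by
  rw [loopLift, TensorProduct.lift.tmul]
  have h : (LaurentPolynomial.T n : ℂ[T;T⁻¹]) = AddMonoidAlgebra.basis ℤ ℂ n := rfl
  rw [h, Module.Basis.constr_basis]

theorem loop_induction {p : ℂ[T;T⁻¹] ⊗[ℂ] X → Prop}
    (T_tmul : ∀ n a, p (LaurentPolynomial.T n ⊗ₜ a)) (add : ∀ x y, p x → p y → p (x + y))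
    (x : ℂ[T;T⁻¹] ⊗[ℂ] X) : p x := by
  induction x using TensorProduct.induction_on with
  | zero => simpa using T_tmul 0 0
  | add x y hx hy => exact add x y hx hy
  | tmul f a =>
    induction f using LaurentPolynomial.induction_on' with
    | add f g hf hg => rw [TensorProduct.add_tmul]; exact add _ _ hf hg
    | C_mul_T n r =>
      rw [← LaurentPolynomial.smul_eq_C_mul, TensorProduct.smul_tmul]
      exact T_tmul n _

end LoopMaps

variable {𝔤 : Type*} [AddCommGroup 𝔤] [Module ℂ 𝔤] [LeibnizAlgebra 𝔤]
variable {M : Type*} [AddCommGroup M] [Module ℂ M]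

theorem T_tmul_bracket (m n : ℤ) (a b : 𝔤) :
    ⁅(LaurentPolynomial.T m ⊗ₜ a : Loop 𝔤), (LaurentPolynomial.T n ⊗ₜ b : Loop 𝔤)⁆ =
      LaurentPolynomial.T (m + n) ⊗ₜ ⁅a, b⁆ := by
  rw [LaurentPolynomial.T_add]
  exact loopBracket_tmul 𝔤 _ _ a b

theorem LeftModule.field_commutator (σ : LeftModule (Loop 𝔤) M) (a b : 𝔤) (m n : ℤ) (w : M) :
    σ.field a m (σ.field b n w) - σ.field b n (σ.field a m w) = σ.field ⁅a, b⁆ (m + n) w := by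
  rw [LeftModule.field, LeftModule.field, LeftModule.field, σ.act_bracket, T_tmul_bracket]

/-- The linear map sending `a` to the coefficient `a ⊗ tⁿ`. -/
def LeftModule.fieldLin (σ : LeftModule (Loop 𝔤) M) (n : ℤ) : 𝔤 →ₗ[ℂ] Module.End ℂ M :=
  σ.act ∘ₗ TensorProduct.mk ℂ ℂ[T;T⁻¹] 𝔤 (LaurentPolynomial.T n)

theorem LeftModule.fieldLin_apply (σ : LeftModule (Loop 𝔤) M) (n : ℤ) (a : 𝔤) :
    σ.fieldLin n a = σ.field a n := rfl

/-- `[a, a] ⊗ tⁿ` acts as the commutator of `a ⊗ tⁿ` and `a ⊗ 1` in either order, hence equals its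
own negative. This makes the action factor through `L(𝔤_Lie)`. -/
theorem LeftModule.squares_le_ker_fieldLin (σ : LeftModule (Loop 𝔤) M) (n : ℤ) :
    squares 𝔤 ≤ LinearMap.ker (σ.fieldLin n) := by
  refine Submodule.span_le.mpr ?_
  rintro _ ⟨a, rfl⟩
  refine LinearMap.ext fun w => ?_
  have h1 := σ.field_commutator a a n 0 w
  have h2 := σ.field_commutator a a 0 n w
  rw [add_zero] at h1
  rw [zero_add, ← neg_sub, h1] at h2
  rw [LeftModule.fieldLin_apply, LinearMap.zero_apply]
  have h3 : (2 : ℂ) • σ.field ⁅a, a⁆ n w = 0 := by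
    rw [two_smul]; nth_rewrite 1 [← h2]; exact neg_add_cancel _
  exact (smul_eq_zero.mp h3).resolve_left two_ne_zero

theorem loopToLieLoop_surjective : Function.Surjective (loopToLieLoop 𝔤) :=
  LinearMap.lTensor_surjective _ (squares 𝔤).mkQ_surjective

/-- A left `L(𝔤)`-module regarded as an `L(𝔤_Lie)`-module, as a linear map. -/
def LeftModule.lieLoopAct (σ : LeftModule (Loop 𝔤) M) : LieLoop 𝔤 →ₗ[ℂ] Module.End ℂ M :=
  loopLift fun n => (squares 𝔤).liftQ (σ.fieldLin n) (σ.squares_le_ker_fieldLin n)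

theorem LeftModule.lieLoopAct_loopToLieLoop (σ : LeftModule (Loop 𝔤) M) (x : Loop 𝔤) :
    σ.lieLoopAct (loopToLieLoop 𝔤 x) = σ.act x := by
  induction x using loop_induction with
  | T_tmul n a => exact loopLift_T_tmul _ n _
  | add x y hx hy => rw [map_add, map_add, map_add, hx, hy]

/-- A left `L(𝔤)`-module regarded as an `L(𝔤_Lie)`-module. -/
def LeftModule.lieLoopHom (σ : LeftModule (Loop 𝔤) M) : LieLoop 𝔤 →ₗ⁅ℂ⁆ Module.End ℂ M where
  toLinearMap := σ.lieLoopAct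
  map_lie' {x y} := by
    obtain ⟨x, rfl⟩ := loopToLieLoop_surjective x
    obtain ⟨y, rfl⟩ := loopToLieLoop_surjective y
    change σ.lieLoopAct _ = ⁅σ.lieLoopAct _, σ.lieLoopAct _⁆
    rw [← loopToLieLoop_bracket, σ.lieLoopAct_loopToLieLoop, σ.lieLoopAct_loopToLieLoop,
      σ.lieLoopAct_loopToLieLoop]
    exact LinearMap.ext fun w => (σ.act_bracket x y w).symm

/-- The action of `U(L(𝔤_Lie))` on a left `L(𝔤)`-module. -/
def LeftModule.envAct (σ : LeftModule (Loop 𝔤) M) : LoopEnv 𝔤 →ₐ[ℂ] Module.End ℂ M :=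
  UniversalEnvelopingAlgebra.lift ℂ σ.lieLoopHom

theorem LeftModule.envAct_ι (σ : LeftModule (Loop 𝔤) M) (x : Loop 𝔤) :
    σ.envAct (UniversalEnvelopingAlgebra.ι ℂ (loopToLieLoop 𝔤 x)) = σ.act x := by
  rw [LeftModule.envAct, UniversalEnvelopingAlgebra.lift_ι_apply]
  exact σ.lieLoopAct_loopToLieLoop x

/-- The canonical map lifts to an algebra map into `S`, and its composite with the inclusion is the
identity because both agree on `L`. -/
theorem envelopingAlgebra_induction {R L : Type*} [CommRing R] [LieRing L] [LieAlgebra R L]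
    (S : Subalgebra R (UniversalEnvelopingAlgebra R L))
    (h : ∀ x : L, UniversalEnvelopingAlgebra.ι R x ∈ S) (s : UniversalEnvelopingAlgebra R L) :
    s ∈ S := by
  let g : L →ₗ⁅R⁆ S :=
    { toFun := fun x => ⟨UniversalEnvelopingAlgebra.ι R x, h x⟩
      map_add' := fun x y => Subtype.ext (map_add _ x y)
      map_smul' := fun r x => Subtype.ext (map_smul _ r x)
      map_lie' := fun {x y} => Subtype.ext (LieHom.map_lie _ x y) }
  have e : S.val.comp (UniversalEnvelopingAlgebra.lift R g) = AlgHom.id R _ := by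
    refine UniversalEnvelopingAlgebra.hom_ext R (LieHom.ext fun x => ?_)
    exact congrArg Subtype.val (UniversalEnvelopingAlgebra.lift_ι_apply R g x)
  have := congrArg (fun f => f s) e
  change ((UniversalEnvelopingAlgebra.lift R g s : S) : _) = s at this
  rw [← this]
  exact Subtype.property _

section Induced

variable {U : Type*} [AddCommGroup U] [Module ℂ U] (ρ : LeftModule 𝔤 U)

theorem Induced.loopModule_act (x : Loop 𝔤) (v : Induced ρ) :
    (Induced.loopModule ρ).act x v = UniversalEnvelopingAlgebra.ι ℂ (loopToLieLoop 𝔤 x) • v :=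
  rfl

variable {ρ} in
/-- The induced module is generated by `U`. -/
theorem Induced.induction {P : Submodule ℂ (Induced ρ)} (incl : ∀ u, Induced.incl ρ u ∈ P)
    (field : ∀ a n x, x ∈ P → (Induced.loopModule ρ).field a n x ∈ P) (x : Induced ρ) : x ∈ P := by
  let S : Subalgebra ℂ (LoopEnv 𝔤) :=
    { carrier := {s | ∀ x ∈ P, s • x ∈ P}
      mul_mem' := fun {s t} hs ht x hx => by rw [mul_smul]; exact hs _ (ht x hx)
      add_mem' := fun {s t} hs ht x hx => by rw [add_smul]; exact P.add_mem (hs x hx) (ht x hx)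
      algebraMap_mem' := fun r x hx => by rw [algebraMap_smul]; exact P.smul_mem r hx }
  have hS : ∀ s, s ∈ S := envelopingAlgebra_induction S fun y => by
    obtain ⟨y, rfl⟩ := loopToLieLoop_surjective y
    induction y using loop_induction with
    | T_tmul n a => exact field a n
    | add y z hy hz => rw [map_add, map_add]; exact S.add_mem hy hz
  obtain ⟨z, rfl⟩ := (inducedRelations ρ).mkQ_surjective x
  induction z using TensorProduct.induction_on with
  | zero => rw [map_zero]; exact P.zero_mem
  | add y z hy hz => rw [map_add]; exact P.add_mem hy hz
  | tmul s u =>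
    have e : s ⊗ₜ[ℂ] u = s • ((1 : LoopEnv 𝔤) ⊗ₜ[ℂ] u) := by
      rw [TensorProduct.smul_tmul', smul_eq_mul, mul_one]
    rw [e, map_smul]
    exact hS s _ (incl u)

/-- In the induced module, `(a ⊗ tⁿ) u` is `a u` for `n = 0` and vanishes for `n > 0`. -/
theorem Induced.field_incl (a : 𝔤) (n : ℕ) (u : U) :
    (Induced.loopModule ρ).field a n (Induced.incl ρ u) =
      if n = 0 then Induced.incl ρ (ρ.act a u) else 0 := by
  have h : (inducedRelations ρ).mkQ (((1 : LoopEnv 𝔤) * envIncl 𝔤 (UniversalEnvelopingAlgebra.ι ℂ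
      ((Polynomial.X ^ n : ℂ[X]) ⊗ₜ toLieQuotient 𝔤 a))) ⊗ₜ[ℂ] u -
      (1 : LoopEnv 𝔤) ⊗ₜ[ℂ] envPlusAction ρ (UniversalEnvelopingAlgebra.ι ℂ
      ((Polynomial.X ^ n : ℂ[X]) ⊗ₜ toLieQuotient 𝔤 a)) u) = 0 :=
    (Submodule.Quotient.mk_eq_zero _).mpr (Submodule.subset_span ⟨_, _, _, rfl⟩)
  rw [map_sub, sub_eq_zero, envPlusAction, envIncl, UniversalEnvelopingAlgebra.lift_ι_apply,
    UniversalEnvelopingAlgebra.lift_ι_apply, plusAction_tmul, one_mul, LieHom.comp_apply] at h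
  have e : loopPlusIncl 𝔤 ((Polynomial.X ^ n : ℂ[X]) ⊗ₜ toLieQuotient 𝔤 a) =
      loopToLieLoop 𝔤 (LaurentPolynomial.T n ⊗ₜ a) := by
    rw [← Polynomial.toLaurent_X_pow]
    rfl
  rw [e] at h
  have h' : (Induced.loopModule ρ).field a n (Induced.incl ρ u) =
      (inducedRelations ρ).mkQ (UniversalEnvelopingAlgebra.ι ℂ
        (loopToLieLoop 𝔤 (LaurentPolynomial.T n ⊗ₜ a)) ⊗ₜ[ℂ] u) := by
    rw [LeftModule.field, Induced.loopModule_act]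
    change _ • (inducedRelations ρ).mkQ ((1 : LoopEnv 𝔤) ⊗ₜ[ℂ] u) = _
    refine ((inducedRelations ρ).mkQ.map_smul _ _).symm.trans ?_
    rw [TensorProduct.smul_tmul', smul_eq_mul, mul_one]
  rw [h', h]
  split_ifs with hn
  · rw [hn, pow_zero, Polynomial.eval_one, one_smul]; rfl
  · rw [Polynomial.eval_pow, Polynomial.eval_X, zero_pow hn, zero_smul, TensorProduct.tmul_zero,
      map_zero]
    rfl

/-- The induced module is a restricted `L(𝔤)`-module. -/
theorem Induced.loopModule_isRestricted : (Induced.loopModule ρ).IsRestricted := by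
  let P : Submodule ℂ (Induced ρ) :=
    { carrier := {w | ∀ a, ∃ N : ℤ, ∀ n, N ≤ n → (Induced.loopModule ρ).field a n w = 0}
      zero_mem' := fun a => ⟨0, fun n _ => map_zero _⟩
      add_mem' := fun {v w} hv hw a => by
        obtain ⟨N, hN⟩ := hv a
        obtain ⟨N', hN'⟩ := hw a
        exact ⟨max N N', fun n hn => by
          rw [map_add, hN n (le_trans (le_max_left _ _) hn),
            hN' n (le_trans (le_max_right _ _) hn), add_zero]⟩
      smul_mem' := fun r w hw a => by
        obtain ⟨N, hN⟩ := hw a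
        exact ⟨N, fun n hn => by rw [map_smul, hN n hn, smul_zero]⟩ }
  suffices h : ∀ w, w ∈ P from fun a w => h w a
  refine Induced.induction (fun u a => ⟨1, fun n hn => ?_⟩) fun b k w hw a => ?_
  · obtain ⟨n, rfl⟩ := Int.eq_ofNat_of_zero_le (by omega : 0 ≤ n)
    rw [Induced.field_incl, if_neg (by omega)]
  · obtain ⟨N, hN⟩ := hw a
    obtain ⟨N', hN'⟩ := hw ⁅a, b⁆
    -- Commuting `a ⊗ tⁿ` past `b ⊗ t^k` leaves `[a, b] ⊗ t^{n+k}`, so its bound is shifted by `k`.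
    refine ⟨max N (N' - k), fun n hn => ?_⟩
    have h := (Induced.loopModule ρ).field_commutator a b n k w
    rw [hN n (le_trans (le_max_left _ _) hn), map_zero, sub_zero,
      hN' (n + k) (by have := le_trans (le_max_right _ _) hn; omega)] at h
    exact h

/-- The universal property of the induced module: existence. -/
theorem Induced.exists_lift (σ : LeftModule (Loop 𝔤) M) (g : U →ₗ[ℂ] M)
    (hg : ∀ (a : 𝔤) (n : ℕ) (u : U),
      σ.field a n (g u) = if n = 0 then g (ρ.act a u) else 0) :
    ∃ Φ : Induced ρ →ₗ[ℂ] M, (∀ u, Φ (Induced.incl ρ u) = g u) ∧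
      ∀ a n x, Φ ((Induced.loopModule ρ).field a n x) = σ.field a n (Φ x) := by
  let Ψ : LoopEnv 𝔤 ⊗[ℂ] U →ₗ[ℂ] M :=
    TensorProduct.lift ((LinearMap.lcomp ℂ M g) ∘ₗ σ.envAct.toLinearMap)
  have hΨ : ∀ s u, Ψ (s ⊗ₜ u) = σ.envAct s (g u) := fun s u => TensorProduct.lift.tmul s u
  have hsmul : ∀ s z, Ψ (s • z) = σ.envAct s (Ψ z) := by
    intro s z
    induction z using TensorProduct.induction_on with
    | zero => rw [smul_zero, map_zero, map_zero]
    | add y z hy hz => rw [smul_add, map_add, map_add, map_add, hy, hz]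
    | tmul t u => rw [TensorProduct.smul_tmul', smul_eq_mul, hΨ, hΨ, map_mul]; rfl
  -- The hypothesis on `g` is equivariance for the generators `a ⊗ tⁿ` with `n ≥ 0`; it extends to
  -- all of `U(L(𝔤_Lie)⁺)`, which makes the defining relations die under `Ψ`.
  have hplus : ∀ (p : LoopPlusEnv 𝔤) (u : U),
      σ.envAct (envIncl 𝔤 p) (g u) = g (envPlusAction ρ p u) := by
    let S : Subalgebra ℂ (LoopPlusEnv 𝔤) :=
      { carrier := {p | ∀ u, σ.envAct (envIncl 𝔤 p) (g u) = g (envPlusAction ρ p u)}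
        mul_mem' := fun {p q} hp hq u => by
          rw [map_mul, map_mul, map_mul, Module.End.mul_apply, Module.End.mul_apply, hq, hp]
        add_mem' := fun {p q} hp hq u => by
          rw [map_add, map_add, map_add, LinearMap.add_apply, LinearMap.add_apply, map_add, hq, hp]
        algebraMap_mem' := fun r u => by
          rw [AlgHom.commutes, AlgHom.commutes, AlgHom.commutes, Module.algebraMap_end_apply,
            Module.algebraMap_end_apply, map_smul] }
    refine envelopingAlgebra_induction S fun x => ?_
    induction x using TensorProduct.induction_on with
    | zero => rw [map_zero]; exact S.zero_mem
    | add x y hx hy => rw [map_add]; exact S.add_mem hx hy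
    | tmul f y =>
      obtain ⟨a, rfl⟩ : ∃ a, toLieQuotient 𝔤 a = y := (squares 𝔤).mkQ_surjective y
      induction f using Polynomial.induction_on' with
      | add f f' hf hf' => rw [TensorProduct.add_tmul, map_add]; exact S.add_mem hf hf'
      | monomial n r =>
        rw [← mul_one r, ← smul_eq_mul, ← Polynomial.smul_monomial, ← TensorProduct.smul_tmul',
          map_smul]
        refine S.smul_mem (fun u => ?_) r
        have e : loopPlusIncl 𝔤 ((Polynomial.monomial n 1 : ℂ[X]) ⊗ₜ toLieQuotient 𝔤 a) =
            loopToLieLoop 𝔤 (LaurentPolynomial.T n ⊗ₜ a) := by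
          rw [← Polynomial.toLaurent_X_pow, Polynomial.X_pow_eq_monomial]
          rfl
        rw [envPlusAction, envIncl, UniversalEnvelopingAlgebra.lift_ι_apply,
          UniversalEnvelopingAlgebra.lift_ι_apply, plusAction_tmul, LieHom.comp_apply, e,
          LeftModule.envAct_ι]
        refine (hg a n u).trans ?_
        rw [Polynomial.eval_monomial, one_mul, map_smul]
        split_ifs with hn
        · rw [hn, pow_zero, one_smul]
        · rw [zero_pow hn, zero_smul]
  have hker : (inducedRelations ρ).restrictScalars ℂ ≤ LinearMap.ker Ψ := by
    intro z hz
    rw [LinearMap.mem_ker]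
    refine Submodule.span_induction (p := fun z _ => Ψ z = 0) ?_ (map_zero _) ?_ ?_
      (show z ∈ inducedRelations ρ from hz)
    · rintro _ ⟨s, p, u, rfl⟩
      rw [map_sub, hΨ, hΨ, map_mul, Module.End.mul_apply, hplus, sub_self]
    · intro x y _ _ hx hy
      rw [map_add, hx, hy, add_zero]
    · intro s x _ hx
      rw [hsmul, hx, map_zero]
  let Φ : Induced ρ →ₗ[ℂ] M := (Submodule.liftQ _ Ψ hker) ∘ₗ
    (Submodule.Quotient.restrictScalarsEquiv ℂ (inducedRelations ρ)).symm.toLinearMap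
  have hΦ : ∀ z, Φ ((inducedRelations ρ).mkQ z) = Ψ z := fun z => rfl
  refine ⟨Φ, fun u => ?_, fun a n x => ?_⟩
  · refine (hΦ _).trans ?_
    rw [hΨ, map_one, Module.End.one_apply]
  · obtain ⟨z, rfl⟩ := (inducedRelations ρ).mkQ_surjective x
    have : (Induced.loopModule ρ).field a n ((inducedRelations ρ).mkQ z) =
        (inducedRelations ρ).mkQ (UniversalEnvelopingAlgebra.ι ℂ
          (loopToLieLoop 𝔤 (LaurentPolynomial.T n ⊗ₜ a)) • z) := by
      rw [map_smul]; rfl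
    rw [this, hΦ, hΦ, hsmul, LeftModule.envAct_ι]
    rfl

end Induced

/-! ### The vertex operator map on a restricted module, its Jacobi identity and its uniqueness. -/

open VertexOperator

variable {𝔤 : Type*} [AddCommGroup 𝔤] [Module ℂ 𝔤] [LeibnizAlgebra 𝔤]
variable {W : Type*} [AddCommGroup W] [Module ℂ W] {ρ : LeftModule (Loop 𝔤) W}

/-- The vertex operators `a(x)` on a restricted `L(𝔤)`-module. -/
def LeftModule.IsRestricted.fieldOp (hρ : ρ.IsRestricted) : 𝔤 →ₗ[ℂ] VertexOperator ℂ W where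
  toFun a := ofNCoeff (ρ.field a) (hρ a)
  map_add' a b := ncoeff_injective <| funext fun n => by
    rw [map_add, Pi.add_apply]
    simp only [ncoeff_ofNCoeff]
    exact map_add (ρ.fieldLin n) a b
  map_smul' r a := ncoeff_injective <| funext fun n => by
    rw [map_smul, Pi.smul_apply]
    simp only [ncoeff_ofNCoeff]
    exact map_smul (ρ.fieldLin n) r a

variable (hρ : ρ.IsRestricted)

theorem LeftModule.IsRestricted.ncoeff_fieldOp (a : 𝔤) : ncoeff (hρ.fieldOp a) = ρ.field a :=
  funext fun n => ncoeff_ofNCoeff _ (hρ a) n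

theorem LeftModule.IsRestricted.fieldOp_isLocal (a b : 𝔤) :
    IsLocal (hρ.fieldOp a) (hρ.fieldOp b) ∧
      nthProd 0 (hρ.fieldOp a) (hρ.fieldOp b) = hρ.fieldOp ⁅a, b⁆ ∧
      ∀ n : ℤ, 0 < n → nthProd n (hρ.fieldOp a) (hρ.fieldOp b) = 0 :=
  isLocal_of_commutator fun m n w => by
    simp only [hρ.ncoeff_fieldOp]
    exact ρ.field_commutator a b m n w

/-- The space of vertex operators on a restricted `L(𝔤)`-module as an `L(𝔤)`-module, `a ⊗ tⁿ`
acting by the `n`-th product with `a(x)`. -/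
def LeftModule.IsRestricted.nthProdModule : LeftModule (Loop 𝔤) (VertexOperator ℂ W) where
  act := loopLift (M := Module.End ℂ (VertexOperator ℂ W)) fun n =>
    LinearMap.comp (M₃ := Module.End ℂ (VertexOperator ℂ W)) (nthProd n) hρ.fieldOp
  act_bracket x y C := by
    induction x using loop_induction with
    | add x x' hx hx' =>
      rw [add_bracket, map_add, map_add, LinearMap.add_apply, LinearMap.add_apply,
        LinearMap.add_apply, map_add, ← hx, ← hx']
      abel
    | T_tmul m a =>
      induction y using loop_induction with
      | add y y' hy hy' =>
        rw [bracket_add, map_add, map_add, LinearMap.add_apply, LinearMap.add_apply,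
          LinearMap.add_apply, map_add, ← hy, ← hy']
        abel
      | T_tmul n b =>
        rw [T_tmul_bracket]
        simp only [loopLift_T_tmul, LinearMap.comp_apply]
        refine ncoeff_injective <| funext fun k => LinearMap.ext fun w => ?_
        obtain ⟨hloc, h0, hpos⟩ := hρ.fieldOp_isLocal a b
        -- Only the product with `i = 0` survives, giving `[a, b](x)_{m+n} C`. No locality of `C`
        -- enters, so all vertex operators form a module.
        rw [map_sub, Pi.sub_apply, LinearMap.sub_apply, hloc.nthProd_commutator C m n k w,
          finsum_eq_single _ 0]
        · rw [Ring.choose_zero_right, one_smul, Nat.cast_zero, sub_zero, h0]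
        · intro i hi
          rw [hpos i (by omega), map_zero, LinearMap.zero_apply, map_zero, Pi.zero_apply,
            LinearMap.zero_apply, smul_zero]

theorem LeftModule.IsRestricted.nthProdModule_field (a : 𝔤) (n : ℤ) (C : VertexOperator ℂ W) :
    hρ.nthProdModule.field a n C = nthProd n (hρ.fieldOp a) C :=
  LinearMap.congr_fun (loopLift_T_tmul _ n a) C

theorem LeftModule.IsRestricted.exists_vertexMap :
    ∃ Φ : VMod 𝔤 →ₗ[ℂ] VertexOperator ℂ W,
      (∀ a, Φ (toVMod 𝔤 a) = hρ.fieldOp a) ∧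
      ∀ a n x, Φ ((vmodModule 𝔤).field a n x) = hρ.nthProdModule.field a n (Φ x) :=
  Induced.exists_lift (adjointModule 𝔤) hρ.nthProdModule hρ.fieldOp fun a n b => by
    rw [hρ.nthProdModule_field]
    split_ifs with hn
    · rw [hn]; exact (hρ.fieldOp_isLocal a b).2.1
    · exact (hρ.fieldOp_isLocal a b).2.2 n (by omega)

/-- The map `v ↦ Y_W(v, x)` from `V_𝔤` to the vertex operators on a restricted `L(𝔤)`-module. -/
def LeftModule.IsRestricted.vertexMap : VMod 𝔤 →ₗ[ℂ] VertexOperator ℂ W :=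
  hρ.exists_vertexMap.choose

theorem LeftModule.IsRestricted.vertexMap_toVMod (a : 𝔤) :
    hρ.vertexMap (toVMod 𝔤 a) = hρ.fieldOp a :=
  hρ.exists_vertexMap.choose_spec.1 a

theorem LeftModule.IsRestricted.vertexMap_field (a : 𝔤) (n : ℤ) (x : VMod 𝔤) :
    hρ.vertexMap ((vmodModule 𝔤).field a n x) = nthProd n (hρ.fieldOp a) (hρ.vertexMap x) := by
  rw [← hρ.nthProdModule_field]
  exact hρ.exists_vertexMap.choose_spec.2 a n x

theorem LeftModule.IsRestricted.fieldOp_isLocal_vertexMap (a : 𝔤) (v : VMod 𝔤) :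
    IsLocal (hρ.fieldOp a) (hρ.vertexMap v) := by
  -- The induction runs over all `a` at once: Dong's lemma for `b(x)_n x` against `a(x)` needs `x`
  -- to be local with both `a(x)` and `b(x)`.
  suffices h : v ∈ ⨅ a, (localSubmodule (hρ.fieldOp a)).comap hρ.vertexMap from
    (Submodule.mem_iInf _).mp h a
  refine Induced.induction (fun b => ?_) (fun b n x hx => ?_) v <;>
    rw [Submodule.mem_iInf] at * <;> intro a
  · change IsLocal _ (hρ.vertexMap (toVMod 𝔤 b))
    rw [hρ.vertexMap_toVMod]
    exact (hρ.fieldOp_isLocal a b).1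
  · change IsLocal _ (hρ.vertexMap ((vmodModule 𝔤).field b n x))
    rw [hρ.vertexMap_field]
    exact (IsLocal.nthProd (hx b) (hρ.fieldOp_isLocal b a).1 (IsLocal.symm (hx a)) n).symm

theorem LeftModule.IsRestricted.vertexMap_isLocal (u v : VMod 𝔤) :
    IsLocal (hρ.vertexMap u) (hρ.vertexMap v) := by
  refine IsLocal.symm ?_
  refine Induced.induction (P := (localSubmodule (hρ.vertexMap v)).comap hρ.vertexMap)
    (fun a => ?_) (fun a n x hx => ?_) u
  · change IsLocal _ (hρ.vertexMap (toVMod 𝔤 a))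
    rw [hρ.vertexMap_toVMod]
    exact (hρ.fieldOp_isLocal_vertexMap a v).symm
  · change IsLocal _ (hρ.vertexMap ((vmodModule 𝔤).field a n x))
    rw [hρ.vertexMap_field]
    exact (IsLocal.nthProd (hρ.fieldOp_isLocal_vertexMap a x)
      (hρ.fieldOp_isLocal_vertexMap a v) (IsLocal.symm hx) n).symm

variable (𝔤) in
theorem vmodModule_isRestricted : (vmodModule 𝔤).IsRestricted :=
  Induced.loopModule_isRestricted (adjointModule 𝔤)

/-- `Y_W(u_n v, x)` is the `n`-th product of `Y_W(u, x)` and `Y_W(v, x)`. -/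
theorem LeftModule.IsRestricted.vertexMap_ncoeff (u v : VMod 𝔤) (n : ℤ) :
    hρ.vertexMap (ncoeff ((vmodModule_isRestricted 𝔤).vertexMap u) n v) =
      nthProd n (hρ.vertexMap u) (hρ.vertexMap v) := by
  set Y := (vmodModule_isRestricted 𝔤).vertexMap with hY
  let P : Submodule ℂ (VMod 𝔤) :=
    { carrier := {u | ∀ n v, hρ.vertexMap (ncoeff (Y u) n v) =
        nthProd n (hρ.vertexMap u) (hρ.vertexMap v)}
      zero_mem' := fun n v => by
        simp only [map_zero, Pi.zero_apply, LinearMap.zero_apply]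
      add_mem' := fun {u u'} hu hu' n v => by
        simp only [map_add, Pi.add_apply, LinearMap.add_apply, hu n v, hu' n v]
      smul_mem' := fun r u hu n v => by
        simp only [map_smul, Pi.smul_apply, LinearMap.smul_apply, hu n v] }
  suffices h : u ∈ P from h n v
  refine Induced.induction (fun a n v => ?_) (fun a m u hu n v => ?_) u
  · change hρ.vertexMap (ncoeff (Y (toVMod 𝔤 a)) n v) =
      nthProd n (hρ.vertexMap (toVMod 𝔤 a)) (hρ.vertexMap v)
    rw [hY, LeftModule.IsRestricted.vertexMap_toVMod, LeftModule.IsRestricted.vertexMap_toVMod,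
      LeftModule.IsRestricted.ncoeff_fieldOp, hρ.vertexMap_field]
  · change hρ.vertexMap (ncoeff (Y ((vmodModule 𝔤).field a m u)) n v) =
      nthProd n (hρ.vertexMap ((vmodModule 𝔤).field a m u)) (hρ.vertexMap v)
    refine ncoeff_injective <| funext fun k => LinearMap.ext fun w => ?_
    -- A single coefficient at `w`, so that the map can be carried through the finite sums.
    let L : VMod 𝔤 →ₗ[ℂ] W :=
      { toFun := fun v => ncoeff (hρ.vertexMap v) k w
        map_add' := fun v v' => by simp only [map_add, Pi.add_apply, LinearMap.add_apply]
        map_smul' := fun r v => by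
          simp only [map_smul, Pi.smul_apply, LinearMap.smul_apply, RingHom.id_apply] }
    have hL : ∀ (A B : VertexOperator ℂ (VMod 𝔤)) (l m n : ℤ) (v : VMod 𝔤),
        L (jacobiProd A B l m n v) = ∑ᶠ i : ℕ, ((-1 : ℤ) ^ i * Ring.choose l i) •
          L (ncoeff A (l + m - i) (ncoeff B (n + i) v)) := by
      intro A B l m n v
      rw [jacobiProd]
      refine (L.toAddMonoidHom.map_finsum (jacobi_support_finite A B _ n v _)).trans ?_
      exact finsum_congr fun i => map_zsmul L _ _
    have hu' : ∀ n v, hρ.vertexMap (ncoeff (Y u) n v) =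
        nthProd n (hρ.vertexMap u) (hρ.vertexMap v) := hu
    have ha : ∀ n v, hρ.vertexMap (ncoeff ((vmodModule_isRestricted 𝔤).fieldOp a) n v) =
        nthProd n (hρ.fieldOp a) (hρ.vertexMap v) := fun n v => by
      rw [LeftModule.IsRestricted.ncoeff_fieldOp, hρ.vertexMap_field]
    change L _ = _
    -- On `V_𝔤`, the operator of `(a ⊗ t^m) u` is an n-th product and expands into sums of `a_{m-i}
    -- u_{n+i} v` and `u_{m+n-i} a_i v`. Their images match term by term the expansion of `(A_m B)_n
    -- C` on `W`.
    rw [hY, LeftModule.IsRestricted.vertexMap_field, ncoeff_nthProd, jacobiDiff_apply,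
      jacobiRevProd_eq_jacobiProd, hρ.vertexMap_field, nthProd_nthProd
        (hρ.fieldOp_isLocal_vertexMap a v) (hρ.vertexMap_isLocal u v), map_sub,
      Units.smul_def, map_zsmul, ← Units.smul_def, hL, hL, ← hY]
    simp only [L, LinearMap.coe_mk, AddHom.coe_mk, ha, hu', add_zero, zero_add]

/-- Upper negation of binomial coefficients; it reconciles the delta function coefficients in
`jacobiIterate` with those obtained from locality. -/
theorem neg_one_pow_mul_choose (m : ℤ) (i : ℕ) :
    (-1 : ℤ) ^ i * Ring.choose ((i : ℤ) - m - 1) i = Ring.choose m i := by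
  have h := Ring.choose_neg (-m) i
  rw [neg_neg] at h
  rw [h, show -m + (i : ℤ) - 1 = i - m - 1 by ring, Units.smul_def, smul_eq_mul]
  simp [Int.negOnePow]

theorem LeftModule.IsRestricted.vertexMap_jacobi :
    JacobiIdentity (vmodModule_isRestricted 𝔤).vertexMap hρ.vertexMap := fun u v l m n w => by
  rw [← jacobiDiff_apply, (hρ.vertexMap_isLocal u v).jacobiDiff_eq_finsum, jacobiIterate]
  exact finsum_congr fun i => by rw [neg_one_pow_mul_choose, hρ.vertexMap_ncoeff]

/-- A map satisfying the Jacobi identity is determined by its restriction to `𝔤`. -/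
theorem LeftModule.IsRestricted.eq_vertexMap {Y : VMod 𝔤 →ₗ[ℂ] VertexOperator ℂ (VMod 𝔤)}
    {YW : VMod 𝔤 →ₗ[ℂ] VertexOperator ℂ W} (hJ : JacobiIdentity Y YW)
    (hY : ∀ a, ncoeff (Y (toVMod 𝔤 a)) = (vmodModule 𝔤).field a)
    (hYW : ∀ a, ncoeff (YW (toVMod 𝔤 a)) = ρ.field a) : YW = hρ.vertexMap := by
  have h0 : ∀ a, YW (toVMod 𝔤 a) = hρ.fieldOp a := fun a =>
    ncoeff_injective (by rw [hYW, hρ.ncoeff_fieldOp])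
  refine LinearMap.ext fun u => ?_
  refine Induced.induction (P := LinearMap.eqLocus YW hρ.vertexMap) (fun a => ?_)
    (fun a n x hx => ?_) u
  · exact (h0 a).trans (hρ.vertexMap_toVMod a).symm
  · change YW ((vmodModule 𝔤).field a n x) = hρ.vertexMap ((vmodModule 𝔤).field a n x)
    replace hx : YW x = hρ.vertexMap x := hx
    refine ncoeff_injective <| funext fun k => LinearMap.ext fun w => ?_
    -- With middle exponent zero the iterate reduces to its term `i = 0`, so the Jacobi identity
    -- says that `YW` sends `a_n x` to the n-th product.
    have h := hJ (toVMod 𝔤 a) x n 0 k w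
    rw [← jacobiDiff_apply, ← ncoeff_nthProd, jacobiIterate, finsum_eq_single _ 0] at h
    · rw [hρ.vertexMap_field, ← h0, ← hx, h, hY]
      simp
    · intro i hi
      rw [neg_one_pow_mul_choose, Ring.choose_zero_pos ℤ (Nat.pos_of_ne_zero hi), zero_smul]

end LeibnizAlgebra

end

theorem theorem3p5 (𝔤 : Type*) [AddCommGroup 𝔤] [Module ℂ 𝔤] [LeibnizAlgebra 𝔤] :
    ∃ S : VertexLeibnizStructure (LeibnizAlgebra.VMod 𝔤),
      (∀ a : 𝔤, VertexOperator.ncoeff (S.Y (LeibnizAlgebra.toVMod 𝔤 a)) =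
        (LeibnizAlgebra.vmodModule 𝔤).field a) ∧
      (∀ S' : VertexLeibnizStructure (LeibnizAlgebra.VMod 𝔤),
        (∀ a : 𝔤, VertexOperator.ncoeff (S'.Y (LeibnizAlgebra.toVMod 𝔤 a)) =
          (LeibnizAlgebra.vmodModule 𝔤).field a) → S' = S) ∧
      ∀ (W : Type*) [AddCommGroup W] [Module ℂ W]
        (ρ : LeibnizAlgebra.LeftModule (LeibnizAlgebra.Loop 𝔤) W), ρ.IsRestricted →
        ∃! M : VertexLeibnizModule S W,
          ∀ a : 𝔤, VertexOperator.ncoeff (M.YW (LeibnizAlgebra.toVMod 𝔤 a)) = ρ.field a := by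
  have hV := LeibnizAlgebra.vmodModule_isRestricted 𝔤
  have hYa : ∀ a, VertexOperator.ncoeff (hV.vertexMap (LeibnizAlgebra.toVMod 𝔤 a)) =
      (LeibnizAlgebra.vmodModule 𝔤).field a :=
    fun a => by rw [hV.vertexMap_toVMod, hV.ncoeff_fieldOp]
  refine ⟨⟨hV.vertexMap, hV.vertexMap_jacobi⟩, hYa, ?_, ?_⟩
  · rintro ⟨Y', hJ⟩ hY'
    -- The structure is treated as a module over itself, so `Y'` takes both roles.
    obtain rfl := hV.eq_vertexMap hJ hY' hY'
    rfl
  · intro W _ _ ρ hρ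
    refine ⟨⟨hρ.vertexMap, hρ.vertexMap_jacobi⟩, fun a => ?_, ?_⟩
    · exact (congrArg _ (hρ.vertexMap_toVMod a)).trans (hρ.ncoeff_fieldOp a)
    · rintro ⟨YW, hJ⟩ hYW
      obtain rfl := hρ.eq_vertexMap hJ hYa hYW
      rfl
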